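/- **Setting.** Consider a renormalizable spontaneously broken gauge theory in four-dimensional Minkowski space (signature $(+,-,-,-)$), with the coupling constants absorbed into the generators. It has gauge bosons $W_{a\mu}$, of which those with broken index $\alpha$ have mass $m_\alpha>0$ and the others are massless ($m_a=0$); real scalars $\Phi_A=(\phi_\alpha,\,v_i+H_i)$ (one Goldstone boson $\phi_\alpha$ per broken generator, Higgs fields $H_i$); fermions $\psi_i,\bar\psi_i$. The structure constants $f^{abc}$ are totally antisymmetric and satisfy the Jacobi identity. The scalar generators $T^a_{AB}$ are real antisymmetric with $[T^a,T^b]=f^{abc}T^c$, the fermion generators $\tau^a_{L},\tau^a_R$ are hermitian with $[\tau^a,\tau^b]=i f^{abc}\tau^c$. The vacuum $\Phi_0=(0,v)$ satisfies $(T^a\Phi_0)_\alpha=m_\alpha\delta_{a\alpha}$, $(T^a\Phi_0)_i=0$. The quartic potential $V$ is gauge invariant and stationary at $\Phi_0$, and the Yukawa matrices satisfy $-i\tau^a_RX^A+iX^A\tau^a_L=X^BT^a_{BA}$. The BRS transformations are $$\delta W_{a\mu}=\partial_\mu c_a+f^{abc}W_{b\mu}c_c,\quad \delta\Phi_A=-c_aT^a_{AB}\Phi_B,\quad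 \delta\psi=i c_a(\tau_L^aP_L+\tau_R^aP_R)\psi,$$ $$\delta\bar\psi=-ic_a\bar\psi(\tau_L^aP_R+\tau_R^aP_L),\quad \delta c_a=-\tfrac12f^{abc}c_bc_c .$$ Write $T^b_{\Phi'\Phi}$ for the coefficients of the homogeneous part, $\delta\Phi'=c_bT^b_{\Phi'\Phi}\Phi+\dots$, for all fields $\Phi,\Phi'$ among $W,\phi,H,\psi,\bar\psi$. The gauge fixing function is $G_a=\partial_\mu W_a^\mu-\xi m_a\phi_a$ with $\xi\neq0$, and the auxiliary field is eliminated by its equation of motion, $B_a=-\frac1\xi G_a$. The classical action is $$S=\int d^4x\Bigl[-\tfrac14F_{a\mu\nu}F_a^{\mu\nu}+\tfrac12D_\mu\Phi_AD^\mu\Phi_A-V(\Phi)+i\bar\psi\gamma^\mu D_\mu\psi+\bar\psi\,\Phi_A(X^AP_L+X^{A\dagger}P_R)\psi-\tfrac1{2\xi}G_a^2-\bar c_a\,\delta G_a+\sum_\Psi\Psi^\star\delta\Psi\Bigr],$$ where $F_{a\mu\nu}=\partial_\mu W_{a\nu}-\partial_\nu W_{a\mu}+f^{abc}W_{b\mu}W_{c\nu}$,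 $D_\mu\Phi_A=\partial_\mu\Phi_A+T^a_{AB}W_{a\mu}\Phi_B$, $D_\mu\psi=\partial_\mu\psi-iW_{a\mu}(\tau^a_LP_L+\tau^a_RP_R)\psi$, and $\Psi$ runs over $W,\phi,H,\psi,\bar\psi,c$, with sources $\Psi^\star$ of statistics opposite to $\Psi$. Define $$\mathcal D_a(x)=-\Bigl(\partial_\mu\frac{\delta}{\delta W_{a\mu}(x)}+m_a\frac{\delta}{\delta\phi_a(x)}\Bigr),\qquad\text{in momentum space}\quad \mathcal D_a(p)=-ip_\mu W_a^\mu(p)-m_a\phi_a(p),$$ where the $\phi_a$-term is absent for massless gauge bosons. All momenta are incoming. $\Gamma(\Phi_1(k_1)\cdots\Phi_n(k_n))$ denotes the irreducible vertex, i.e. the Fourier transform of $i\,\delta^n\Gamma/\delta\Phi_1\cdots\delta\Phi_n$ at vanishing fields and sources without the momentum-conserving delta function. At tree level $\Gamma=S$, and the ordering of anticommuting fields is such that a monomial $\Psi_1\cdots\Psi_n$ has coefficient $+1$ in $\Gamma(\Psi_1\cdots\Psi_n)$. **Statement.** (1) Let $\Gamma$ be any (formal power series) functional of the fields and sources that satisfies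 the Zinn-Justin equation $$\int d^4x\Bigl[\sum_\Psi\frac{\delta_L\Gamma}{\delta\Psi^\star}\frac{\delta_L\Gamma}{\delta\Psi}+B_a\frac{\delta_L\Gamma}{\delta\bar c_a}\Bigr]=0 .$$ Then for every $a$, to all orders in the fields and sources (here and in the equation above, all coefficients of the expansion in fields and sources vanish), $$0=\int d^4x\Bigl[\sum_\Psi\Bigl(\mathcal D_a\frac{\delta_L\Gamma}{\delta\Psi^\star}\Bigr)\frac{\delta_L\Gamma}{\delta\Psi}+\frac{\delta_L\Gamma}{\delta\Psi^\star}\Bigl(\mathcal D_a\frac{\delta_L\Gamma}{\delta\Psi}\Bigr)+(\mathcal D_aB_b)\frac{\delta_L\Gamma}{\delta\bar c_b}+B_b\Bigl(\mathcal D_a\frac{\delta_L\Gamma}{\delta\bar c_b}\Bigr)\Bigr].$$ (2) At tree level, for all $a,b$ and all momenta of vanishing sum, the three-point vertices satisfy, for $\Phi$ a Higgs field, $\psi$ or $\bar\psi$, $$\Gamma(\mathcal D_a(p_a)\mathcal D_b(p_b)\Phi(k))=i f^{cab}p_{a\mu}\,\Gamma(W_c^\mu(p_a+p_b)\Phi(k))+m_a\sum_{\Phi'}T^b_{\Phi'\phi_a}\,\Gamma(\Phi'(p_a+p_b)\Phi(k)),$$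 and for a third gauge or Goldstone boson $$\Gamma(\mathcal D_a(p_a)\mathcal D_b(p_b)W_{c\nu}(p_c))=i f^{dab}p_{a\mu}\,\Gamma(W_d^\mu(p_a+p_b)W_{c\nu}(p_c))-\tfrac{i}{\xi}\,p_{c\nu}\,\Gamma(\mathcal D_a(p_a)\bar c_c(p_c)c_b(p_b)),$$ $$\Gamma(\mathcal D_a(p_a)\mathcal D_b(p_b)\phi_\gamma(p_c))=m_a\sum_\delta T^b_{\phi_\delta\phi_a}\Gamma(\phi_\delta(p_a+p_b)\phi_\gamma(p_c))-m_\gamma\,\Gamma(\mathcal D_a(p_a)\bar c_\gamma(p_c)c_b(p_b)).$$ (3) At tree level, for all $a,b$, all fields $\Phi_1,\Phi_2$ among $W,\phi,H,\psi,\bar\psi$ and all momenta of vanishing sum, $$\begin{aligned}\Gamma(\mathcal D_a(p_a)\mathcal D_b(p_b)\Phi_1(k_1)\Phi_2(k_2))={}&i f^{cab}p_{a\mu}\,\Gamma(W_c^\mu(p_a+p_b)\Phi_1(k_1)\Phi_2(k_2))+m_a\sum_{\Phi'}T^b_{\Phi'\phi_a}\Gamma(\Phi'(p_a+p_b)\Phi_1(k_1)\Phi_2(k_2))\\&-\sum_{\Phi'}T^b_{\Phi'\Phi_1}\Gamma(\mathcal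 D_a(p_a)\Phi'(p_b+k_1)\Phi_2(k_2))-\sum_{\Phi'}T^b_{\Phi'\Phi_2}\Gamma(\mathcal D_a(p_a)\Phi_1(k_1)\Phi'(p_b+k_2)).\end{aligned}$$ The terms with $m_a$ are absent when $a$ is unbroken. The first two terms on the right-hand side arise from the insertion of $\mathcal D_a$ into a BRS vertex. -/

import Mathlib

open Complex (I)

namespace SBGT

/-- Covariant components `p_μ` of a four-momentum. All momenta are incoming. -/
abbrev Momentum := Fin 4 → ℝ

/-- Diagonal of the Minkowski metric, signature `(+,-,-,-)`. -/
def eta (μ : Fin 4) : ℝ := if μ = 0 then 1 else -1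

/-- Dirac matrices `γ^μ` in the chiral representation. -/
def diracGamma (μ : Fin 4) : Matrix (Fin 4) (Fin 4) ℂ :=
  match μ with
  | 0 => !![0, 0, 1, 0; 0, 0, 0, 1; 1, 0, 0, 0; 0, 1, 0, 0]
  | 1 => !![0, 0, 0, 1; 0, 0, 1, 0; 0, -1, 0, 0; -1, 0, 0, 0]
  | 2 => !![0, 0, 0, -I; 0, 0, I, 0; 0, I, 0, 0; -I, 0, 0, 0]
  | 3 => !![0, 0, 1, 0; 0, 0, 0, -1; -1, 0, 0, 0; 0, 1, 0, 0]

/-- `γ⁵ = i γ⁰ γ¹ γ² γ³`. -/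
noncomputable def diracGamma5 : Matrix (Fin 4) (Fin 4) ℂ :=
  I • (diracGamma 0 * diracGamma 1 * diracGamma 2 * diracGamma 3)

/-- Left-handed projector `(1 - γ⁵) / 2`. -/
noncomputable def projL : Matrix (Fin 4) (Fin 4) ℂ := (1 / 2 : ℂ) • (1 - diracGamma5)

/-- Right-handed projector `(1 + γ⁵) / 2`. -/
noncomputable def projR : Matrix (Fin 4) (Fin 4) ℂ := (1 / 2 : ℂ) • (1 + diracGamma5)

/-! ### Fields

`κ` indexes the broken generators (massive gauge bosons, Goldstone bosons), `ω` the unbroken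
generators (massless gauge bosons), `η` the Higgs (physical scalar) fields and `ν` the fermions. -/

/-- The classical fields other than ghosts: components `W_{aμ}` of the gauge bosons, scalars
(`Sum.inl α` is the Goldstone boson `φ_α`, `Sum.inr i` is the Higgs field `H_i`), and the spinor
components of `ψ_i` and `ψ̄_i`. -/
inductive Fld (κ ω η ν : Type*) where
  | W (a : κ ⊕ ω) (μ : Fin 4)
  | scal (A : κ ⊕ η)
  | psi (i : ν) (s : Fin 4)
  | psibar (i : ν) (s : Fin 4)
  deriving DecidableEq, Fintype

/-- All arguments of the effective action: the fields, ghosts `c_a`, antighosts `c̄_a`, and the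
sources `Φ^⋆`, `c_a^⋆` of the BRS transformations of the fields and of the ghosts. The
Nakanishi-Lautrup field is eliminated by its equation of motion. -/
inductive ClField (κ ω η ν : Type*) where
  | fld (Φ : Fld κ ω η ν)
  | ghost (a : κ ⊕ ω)
  | antighost (a : κ ⊕ ω)
  | src (Φ : Fld κ ω η ν)
  | ghostSrc (a : κ ⊕ ω)
  deriving DecidableEq

/-- Whether a field or source is anticommuting; the source of a BRS transformation has the
statistics opposite to that of the field. -/
def ClField.isOdd {κ ω η ν : Type*} : ClField κ ω η ν → Bool
  | .fld (.W _ _) => false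
  | .fld (.scal _) => false
  | .fld (.psi _ _) => true
  | .fld (.psibar _ _) => true
  | .ghost _ => true
  | .antighost _ => true
  | .src (.W _ _) => true
  | .src (.scal _) => true
  | .src (.psi _ _) => false
  | .src (.psibar _ _) => false
  | .ghostSrc _ => false

/-! ### Functionals of the classical fields -/

/-- An argument of a vertex function: a field together with its incoming momentum. -/
structure Leg (κ ω η ν : Type*) where
  field : ClField κ ω η ν
  mom : Momentum

/-- A formal (power series) functional of the classical fields, inserted at a point (or, for an
action, with the momentum-conserving delta function removed), given by its momentum-space
Taylor coefficients at vanishing fields: `F [ℓ₁, …, ℓₙ]` is the Fourier transform of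
`δ_L/δℓₙ ⋯ δ_L/δℓ₁ F` at zero, so that the product `Ψ₁ ⋯ Ψₙ` of distinct fields has the coefficient
`1` at `[Ψ₁, …, Ψₙ]`. -/
abbrev Func (κ ω η ν : Type*) := List (Leg κ ω η ν) → ℂ

section Functionals

variable {κ ω η ν : Type*}

/-- Total incoming momentum of a list of legs. -/
def totalMom (L : List (Leg κ ω η ν)) : Momentum := (L.map Leg.mom).sum

/-- Left functional derivative in the direction of a leg. -/
def legDeriv (ℓ : Leg κ ω η ν) (F : Func κ ω η ν) : Func κ ω η ν := fun L => F (ℓ :: L)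

/-- The sign for moving the derivative in the direction of `ℓ` past `F`: if `ℓ` is anticommuting,
the odd part of `F` changes its sign. -/
def passSign (ℓ : Leg κ ω η ν) (F : Func κ ω η ν) : Func κ ω η ν :=
  fun L => (if ℓ.field.isOdd ∧ Odd (L.countP fun k => k.field.isOdd) then -1 else 1) * F L

/-- Taylor coefficients of a product, from the graded Leibniz rule
`δ_ℓ (F G) = (δ_ℓ F) G ± F (δ_ℓ G)`. -/
def mulCoeff : List (Leg κ ω η ν) → Func κ ω η ν → Func κ ω η ν → ℂ
  | [], F, G => F [] * G []
  | ℓ :: L, F, G => mulCoeff L (legDeriv ℓ F) G + mulCoeff L (passSign ℓ F) (legDeriv ℓ G)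

/-- Product of two functionals. -/
def opMul (F G : Func κ ω η ν) : Func κ ω η ν := fun L => mulCoeff L F G

/-- The constant functional `1`. -/
def opOne : Func κ ω η ν
  | [] => 1
  | _ :: _ => 0

/-- Space-time derivative `∂_μ`, which acts as `-i p_μ` on incoming momenta. -/
noncomputable def pd (μ : Fin 4) (F : Func κ ω η ν) : Func κ ω η ν :=
  fun L => -I * (totalMom L μ : ℂ) * F L

/-- The functional `Ψ(x)` for a single field `Ψ`. -/
def basic [DecidableEq κ] [DecidableEq ω] [DecidableEq η] [DecidableEq ν]
    (Ψ : ClField κ ω η ν) : Func κ ω η ν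
  | [ℓ] => if ℓ.field = Ψ then 1 else 0
  | _ => 0

/-- The left functional derivative `δ_L Γ / δΨ(x)` of an action `Γ`, as a functional inserted at a
point: momentum conservation fixes the momentum that flows in at the field `Ψ`. -/
def funDeriv (Ψ : ClField κ ω η ν) (Γ : Func κ ω η ν) : Func κ ω η ν :=
  fun L => Γ (⟨Ψ, -totalMom L⟩ :: L)

end Functionals

infixl:70 " ⊠ " => opMul

/-! ### Spontaneously broken gauge theories -/

/-- `∂V/∂φ_A` for `V(φ) = g₂/2 φφ + g₃/3! φφφ + g₄/4! φφφφ` with symmetric coefficients. -/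
noncomputable def gradPotential {S : Type*} [Fintype S] (g2 : S → S → ℝ) (g3 : S → S → S → ℝ)
    (g4 : S → S → S → S → ℝ) (φ : S → ℝ) (A : S) : ℝ :=
  ∑ B, g2 A B * φ B + (1 / 2) * ∑ B, ∑ C, g3 A B C * φ B * φ C
    + (1 / 6) * ∑ B, ∑ C, ∑ D, g4 A B C D * φ B * φ C * φ D

/-- The parameters of a renormalizable spontaneously broken gauge theory (the coupling constants
are absorbed into `f`, `T`, `τ`). -/
structure BrokenGaugeTheory (κ ω η ν : Type*) [Fintype κ] [Fintype ω] [Fintype η] [Fintype ν]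
    [DecidableEq κ] [DecidableEq ω] where
  /-- structure constants -/
  f : κ ⊕ ω → κ ⊕ ω → κ ⊕ ω → ℝ
  f_swap_left : ∀ a b c, f b a c = -f a b c
  f_swap_right : ∀ a b c, f a c b = -f a b c
  jacobi : ∀ a b c d, ∑ e, (f a b e * f c d e + f c a e * f b d e + f a d e * f b c e) = 0
  /-- masses of the massive gauge bosons -/
  m : κ → ℝ
  m_pos : ∀ α, 0 < m α
  /-- real antisymmetric generators in the representation of the scalars -/
  T : κ ⊕ ω → Matrix (κ ⊕ η) (κ ⊕ η) ℝ
  T_antisymm : ∀ a A B, T a B A = -T a A B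
  T_comm : ∀ a b, T a * T b - T b * T a = ∑ c, f a b c • T c
  /-- vacuum expectation values of the Higgs fields -/
  v : η → ℝ
  /-- gauge transformations of the vacuum have no component in Higgs directions -/
  vac_higgs : ∀ a i, ∑ j, T a (Sum.inr i) (Sum.inr j) * v j = 0
  /-- the gauge boson mass matrix is diagonal; unbroken generators annihilate the vacuum -/
  vac_gold : ∀ a α, ∑ j, T a (Sum.inl α) (Sum.inr j) * v j = if a = Sum.inl α then m α else 0
  /-- coefficients of the scalar potential -/
  g2 : κ ⊕ η → κ ⊕ η → ℝ
  g3 : κ ⊕ η → κ ⊕ η → κ ⊕ η → ℝ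
  g4 : κ ⊕ η → κ ⊕ η → κ ⊕ η → κ ⊕ η → ℝ
  g2_symm : ∀ A B, g2 B A = g2 A B
  g3_symm : ∀ A B C, g3 B A C = g3 A B C ∧ g3 A C B = g3 A B C
  g4_symm : ∀ A B C D, g4 B A C D = g4 A B C D ∧ g4 A C B D = g4 A B C D ∧
    g4 A B D C = g4 A B C D
  /-- gauge invariance of the potential -/
  potential_inv : ∀ (a : κ ⊕ ω) (φ : κ ⊕ η → ℝ),
    ∑ A, ∑ B, gradPotential g2 g3 g4 φ A * T a A B * φ B = 0
  /-- the vacuum is a stationary point of the potential -/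
  potential_vac : ∀ A, gradPotential g2 g3 g4 (Sum.elim 0 v) A = 0
  /-- hermitian generators for the left- and right-handed fermions -/
  τL : κ ⊕ ω → Matrix ν ν ℂ
  τR : κ ⊕ ω → Matrix ν ν ℂ
  τL_herm : ∀ a, (τL a).IsHermitian
  τR_herm : ∀ a, (τR a).IsHermitian
  τL_comm : ∀ a b, τL a * τL b - τL b * τL a = ∑ c, (I * (f a b c : ℂ)) • τL c
  τR_comm : ∀ a b, τR a * τR b - τR b * τR a = ∑ c, (I * (f a b c : ℂ)) • τR c
  /-- Yukawa couplings -/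
  X : κ ⊕ η → Matrix ν ν ℂ
  X_inv : ∀ a A, -(I • (τR a * X A)) + I • (X A * τL a) = ∑ B, (T a B A : ℂ) • X B

namespace BrokenGaugeTheory

variable {κ ω η ν : Type*} [Fintype κ] [Fintype ω] [Fintype η] [Fintype ν]
  [DecidableEq κ] [DecidableEq ω] [DecidableEq η] [DecidableEq ν]

/-- `m_a X(φ_a)` for an expression `X` that depends on a Goldstone boson; it is zero for massless
gauge bosons. -/
def massGold (M : BrokenGaugeTheory κ ω η ν) {E : Type*} [AddCommGroup E] [Module ℝ E]
    (a : κ ⊕ ω) (X : κ → E) : E :=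
  match a with
  | .inl α => M.m α • X α
  | .inr _ => 0

/-! #### The tree-level action -/

/-- The gauge field `W_{aμ}`. -/
def fW (_M : BrokenGaugeTheory κ ω η ν) (a : κ ⊕ ω) (μ : Fin 4) : Func κ ω η ν :=
  basic (.fld (.W a μ))

/-- The scalar multiplet `(φ_α, v_i + H_i)`. -/
noncomputable def fPhi (M : BrokenGaugeTheory κ ω η ν) (A : κ ⊕ η) : Func κ ω η ν :=
  ((Sum.elim 0 M.v A : ℝ) : ℂ) • opOne + basic (.fld (.scal A))

/-- The spinor component `ψ_{i s}`. -/
def fpsi (_M : BrokenGaugeTheory κ ω η ν) (i : ν) (s : Fin 4) : Func κ ω η ν :=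
  basic (.fld (.psi i s))

/-- The spinor component `ψ̄_{i s}`. -/
def fpsibar (_M : BrokenGaugeTheory κ ω η ν) (i : ν) (s : Fin 4) : Func κ ω η ν :=
  basic (.fld (.psibar i s))

/-- The ghost `c_a`. -/
def fc (_M : BrokenGaugeTheory κ ω η ν) (a : κ ⊕ ω) : Func κ ω η ν := basic (.ghost a)

/-- The matrix `τ_L^a P_L + τ_R^a P_R` in flavour and spinor space. -/
noncomputable def tauDirac (M : BrokenGaugeTheory κ ω η ν) (a : κ ⊕ ω) (i j : ν) (s t : Fin 4) :
    ℂ :=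
  M.τL a i j * projL s t + M.τR a i j * projR s t

/-- The matrix `τ_L^a P_R + τ_R^a P_L`, which acts on `ψ̄` from the right. -/
noncomputable def tauDiracBar (M : BrokenGaugeTheory κ ω η ν) (a : κ ⊕ ω) (i j : ν)
    (s t : Fin 4) : ℂ :=
  M.τL a i j * projR s t + M.τR a i j * projL s t

/-- Field strength `F_{aμν} = ∂_μ W_{aν} - ∂_ν W_{aμ} + f^{abc} W_{bμ} W_{cν}`. -/
noncomputable def fieldStrength (M : BrokenGaugeTheory κ ω η ν) (a : κ ⊕ ω) (μ ρ : Fin 4) :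
    Func κ ω η ν :=
  pd μ (M.fW a ρ) - pd ρ (M.fW a μ) + ∑ b, ∑ c, (M.f a b c : ℂ) • (M.fW b μ ⊠ M.fW c ρ)

/-- `L_YM = -1/4 F_a^{μν} F_{aμν}`. -/
noncomputable def lagYM (M : BrokenGaugeTheory κ ω η ν) : Func κ ω η ν :=
  (-1 / 4 : ℂ) • ∑ a, ∑ μ, ∑ ρ,
    ((eta μ * eta ρ : ℝ) : ℂ) • (M.fieldStrength a μ ρ ⊠ M.fieldStrength a μ ρ)

/-- `D_μ Φ_A = ∂_μ Φ_A + T^a_{AB} W_{aμ} Φ_B`. -/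
noncomputable def covPhi (M : BrokenGaugeTheory κ ω η ν) (A : κ ⊕ η) (μ : Fin 4) :
    Func κ ω η ν :=
  pd μ (M.fPhi A) + ∑ a, ∑ B, (M.T a A B : ℂ) • (M.fW a μ ⊠ M.fPhi B)

/-- The scalar potential. -/
noncomputable def lagPotential (M : BrokenGaugeTheory κ ω η ν) : Func κ ω η ν :=
  (1 / 2 : ℂ) • ∑ A, ∑ B, (M.g2 A B : ℂ) • (M.fPhi A ⊠ M.fPhi B)
    + (1 / 6 : ℂ) • ∑ A, ∑ B, ∑ C, (M.g3 A B C : ℂ) • (M.fPhi A ⊠ M.fPhi B ⊠ M.fPhi C)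
    + (1 / 24 : ℂ) • ∑ A, ∑ B, ∑ C, ∑ D,
        (M.g4 A B C D : ℂ) • (M.fPhi A ⊠ M.fPhi B ⊠ M.fPhi C ⊠ M.fPhi D)

/-- `L_Φ = 1/2 D_μ Φ_A D^μ Φ_A - V(Φ)`. -/
noncomputable def lagScalar (M : BrokenGaugeTheory κ ω η ν) : Func κ ω η ν :=
  (1 / 2 : ℂ) • (∑ A, ∑ μ, (eta μ : ℂ) • (M.covPhi A μ ⊠ M.covPhi A μ)) - M.lagPotential

/-- `D_μ ψ = ∂_μ ψ - i W_{aμ} (τ_L^a P_L + τ_R^a P_R) ψ`. -/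
noncomputable def covPsi (M : BrokenGaugeTheory κ ω η ν) (i : ν) (s μ : Fin 4) :
    Func κ ω η ν :=
  pd μ (M.fpsi i s) - I • ∑ a, ∑ j, ∑ t, M.tauDirac a i j s t • (M.fW a μ ⊠ M.fpsi j t)

/-- `L_f = i ψ̄ γ^μ D_μ ψ + ψ̄ Φ_A (X^A P_L + X^{A†} P_R) ψ`. -/
noncomputable def lagFermion (M : BrokenGaugeTheory κ ω η ν) : Func κ ω η ν :=
  I • (∑ i, ∑ μ, ∑ s, ∑ t, diracGamma μ s t • (M.fpsibar i s ⊠ M.covPsi i t μ))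
    + ∑ A, ∑ i, ∑ j, ∑ s, ∑ t,
        (M.X A i j * projL s t + (M.X A).conjTranspose i j * projR s t) •
          (M.fpsibar i s ⊠ M.fPhi A ⊠ M.fpsi j t)

/-- The BRS transformations of the fields. -/
noncomputable def brs (M : BrokenGaugeTheory κ ω η ν) : Fld κ ω η ν → Func κ ω η ν
  | .W a μ => pd μ (M.fc a) + ∑ b, ∑ c, (M.f a b c : ℂ) • (M.fW b μ ⊠ M.fc c)
  | .scal A => -∑ a, ∑ B, (M.T a A B : ℂ) • (M.fc a ⊠ M.fPhi B)
  | .psi i s => I • ∑ a, ∑ j, ∑ t, M.tauDirac a i j s t • (M.fc a ⊠ M.fpsi j t)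
  | .psibar i s => -(I • ∑ a, ∑ j, ∑ t, M.tauDiracBar a j i t s • (M.fc a ⊠ M.fpsibar j t))

/-- The BRS transformation `-1/2 f^{abc} c_b c_c` of the ghosts. -/
noncomputable def brsGhost (M : BrokenGaugeTheory κ ω η ν) (a : κ ⊕ ω) : Func κ ω η ν :=
  (-1 / 2 : ℂ) • ∑ b, ∑ c, (M.f a b c : ℂ) • (M.fc b ⊠ M.fc c)

/-- The linear `R_ξ` gauge fixing function `G_a = ∂_μ W_a^μ - ξ m_a φ_a`. -/
noncomputable def gaugeFix (M : BrokenGaugeTheory κ ω η ν) (ξ : ℝ) (a : κ ⊕ ω) : Func κ ω η ν :=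
  ∑ μ, (eta μ : ℂ) • pd μ (M.fW a μ)
    - (ξ : ℂ) • M.massGold a fun α => basic (.fld (.scal (Sum.inl α)))

/-- The BRS transformation of the gauge fixing function. -/
noncomputable def brsGaugeFix (M : BrokenGaugeTheory κ ω η ν) (ξ : ℝ) (a : κ ⊕ ω) :
    Func κ ω η ν :=
  ∑ μ, (eta μ : ℂ) • pd μ (M.brs (.W a μ))
    - (ξ : ℂ) • M.massGold a fun α => M.brs (.scal (Sum.inl α))

/-- The Nakanishi-Lautrup field at the solution `B_a = -G_a / ξ` of its equation of motion. -/
noncomputable def auxB (M : BrokenGaugeTheory κ ω η ν) (ξ : ℝ) (a : κ ⊕ ω) : Func κ ω η ν :=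
  -((ξ : ℂ)⁻¹ • M.gaugeFix ξ a)

/-- The tree-level effective action, i.e. the classical action with gauge fixing term
`-G_a²/(2ξ)`, ghost term `-c̄_a δ_BRS G_a`, and sources for the BRS transformations. -/
noncomputable def treeAction (M : BrokenGaugeTheory κ ω η ν) (ξ : ℝ) : Func κ ω η ν :=
  M.lagYM + M.lagScalar + M.lagFermion
    - (1 / (2 * ξ) : ℂ) • ∑ a, (M.gaugeFix ξ a ⊠ M.gaugeFix ξ a)
    - ∑ a, (basic (.antighost a) ⊠ M.brsGaugeFix ξ a)
    + ∑ Φ, (basic (.src Φ) ⊠ M.brs Φ)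
    + ∑ a, (basic (.ghostSrc a) ⊠ M.brsGhost a)

/-- The tree-level irreducible vertices `i δⁿΓ/δΦ₁⋯δΦₙ` in momentum space (without the
momentum-conserving delta function). -/
noncomputable def treeVertex (M : BrokenGaugeTheory κ ω η ν) (ξ : ℝ) : Func κ ω η ν :=
  fun L => I * M.treeAction ξ L

/-! #### Zinn-Justin equation and contractions -/

/-- The operator `𝒟_a(p) = -i p_μ δ/δW_{aμ}(p) - m_a δ/δφ_a(p)`, the Fourier transform of
`-(∂_μ δ/δW_{aμ}(x) + m_a δ/δφ_a(x))`. -/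
noncomputable def contr (M : BrokenGaugeTheory κ ω η ν) (a : κ ⊕ ω) (p : Momentum)
    (F : Func κ ω η ν) : Func κ ω η ν :=
  -(I • ∑ μ, (p μ : ℂ) • legDeriv ⟨.fld (.W a μ), p⟩ F)
    - M.massGold a fun α => legDeriv ⟨.fld (.scal (Sum.inl α)), p⟩ F

/-- The Zinn-Justin functional density
`∑_Ψ δΓ/δΨ^⋆(x) δΓ/δΨ(x) + B_a(x) δΓ/δc̄_a(x)`. All derivatives are left derivatives, the
choice which fits BRS transformations that act from the left and sources that stand on the left in
`Ψ^⋆ δ_BRS Ψ`. -/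
noncomputable def zjDensity (M : BrokenGaugeTheory κ ω η ν) (ξ : ℝ) (Γ : Func κ ω η ν) :
    Func κ ω η ν :=
  ∑ Φ, (funDeriv (.src Φ) Γ ⊠ funDeriv (.fld Φ) Γ)
    + ∑ a, (funDeriv (.ghostSrc a) Γ ⊠ funDeriv (.ghost a) Γ)
    + ∑ a, (M.auxB ξ a ⊠ funDeriv (.antighost a) Γ)

/-- The Zinn-Justin equation: the space-time integral of the density vanishes, i.e. all of its
coefficients of vanishing total momentum do. -/
def ZinnJustin (M : BrokenGaugeTheory κ ω η ν) (ξ : ℝ) (Γ : Func κ ω η ν) : Prop :=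
  ∀ L, totalMom L = 0 → M.zjDensity ξ Γ L = 0

/-- The coefficients `T^b_{Φ'Φ}` of the homogeneous part
`δ_BRS Φ' = c_b T^b_{Φ'Φ} Φ + …` of the BRS transformations. -/
noncomputable def brsMatrix (M : BrokenGaugeTheory κ ω η ν) (b : κ ⊕ ω) :
    Fld κ ω η ν → Fld κ ω η ν → ℂ
  | .W c μ, .W d ρ => if μ = ρ then (M.f c d b : ℂ) else 0
  | .scal A, .scal B => -(M.T b A B : ℂ)
  | .psi i s, .psi j t => I * M.tauDirac b i j s t
  | .psibar i s, .psibar j t => -(I * M.tauDiracBar b j i t s)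
  | _, _ => 0

end BrokenGaugeTheory

end SBGT

open SBGT

set_option linter.unusedSectionVars false

namespace SBGT

/-! ### Algebra of functionals: derivatives, signs and products -/

section FunctionalAlgebra

variable {κ ω η ν : Type*}

/-! The operator `𝒟_b` is the derivative along the inhomogeneous part of a gauge transformation: in
momentum space `W_b` is shifted by `-i p` and the scalars by `-T^b v`, which is `-m_b` in the
direction of `φ_b` and zero otherwise. Adding the homogeneous part `rot`, which rotates every leg in
turn, gives the full infinitesimal variation `gaugeVar`. It is a derivation, so invariance of the
classical Lagrangian reduces to the covariance of `Φ`, `ψ`, `ψ̄`, their covariant derivatives and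
`F`, together with invariance of the coupling tensors. The outcome is `contr_invAction`: on the
invariant action, contracting with `𝒟_b` equals minus rotating with `b`.

Contract once more with `𝒟_a`. The contractions commute, and commuting `𝒟_a` through the rotation
(`contr_rot`) leaves a remainder: the rotation may hit the very leg that `𝒟_a` contracts. This
remainder is `insertion`, the two `p_a` and `m_a` terms of the statement. The result is
`contr_contr_invAction`.

Gauge fixing is quadratic in the fields, so it drops out of all three- and four-point vertices made
of fields. For four points the identity is therefore immediate. For three points the rotated term is
a once contracted two-point vertex, which vanishes because the vacuum is stationary. The remaining
insertion involves a two-point vertex of the invariant action only; completing it to the tree vertex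
costs the gauge fixing part, which factorizes into `G_e` on the external leg times an insertion into
`G_e`. By `contr_treeVertex_ghost` the latter is the contracted ghost vertex, since the ghost action
is `-c̄ δG`. The separate three-point formulas follow from the value of `G_e` on the external leg
and from the absence of scalar-gauge and Higgs-Goldstone mixing.

The contracted Zinn-Justin equation is the Leibniz rule for the even derivation `𝒟_a`. -/

theorem passSign_add (ℓ : Leg κ ω η ν) (F G : Func κ ω η ν) :
    passSign ℓ (F + G) = passSign ℓ F + passSign ℓ G := by
  funext L; simp only [passSign, Pi.add_apply, mul_add]

theorem passSign_smul (ℓ : Leg κ ω η ν) (z : ℂ) (F : Func κ ω η ν) :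
    passSign ℓ (z • F) = z • passSign ℓ F := by
  funext L; simp only [passSign, Pi.smul_apply, smul_eq_mul]; ring

theorem passSign_of_even {ℓ : Leg κ ω η ν} (h : ℓ.field.isOdd = false) (F : Func κ ω η ν) :
    passSign ℓ F = F := by
  funext L; simp [passSign, h]

theorem mulCoeff_add_left (L : List (Leg κ ω η ν)) (F F' G : Func κ ω η ν) :
    mulCoeff L (F + F') G = mulCoeff L F G + mulCoeff L F' G := by
  induction L generalizing F F' G with
  | nil => simp [mulCoeff, add_mul]
  | cons ℓ L ih =>
    have h : legDeriv ℓ (F + F') = legDeriv ℓ F + legDeriv ℓ F' := rfl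
    simp only [mulCoeff, h, passSign_add, ih]; ring

theorem mulCoeff_smul_left (L : List (Leg κ ω η ν)) (z : ℂ) (F G : Func κ ω η ν) :
    mulCoeff L (z • F) G = z * mulCoeff L F G := by
  induction L generalizing F G with
  | nil => simp [mulCoeff, mul_assoc]
  | cons ℓ L ih =>
    have h : legDeriv ℓ (z • F) = z • legDeriv ℓ F := rfl
    simp only [mulCoeff, h, passSign_smul, ih]; ring

theorem mulCoeff_add_right (L : List (Leg κ ω η ν)) (F G G' : Func κ ω η ν) :
    mulCoeff L F (G + G') = mulCoeff L F G + mulCoeff L F G' := by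
  induction L generalizing F G G' with
  | nil => simp [mulCoeff, mul_add]
  | cons ℓ L ih =>
    have h : legDeriv ℓ (G + G') = legDeriv ℓ G + legDeriv ℓ G' := rfl
    simp only [mulCoeff, h, ih]; ring

theorem mulCoeff_smul_right (L : List (Leg κ ω η ν)) (z : ℂ) (F G : Func κ ω η ν) :
    mulCoeff L F (z • G) = z * mulCoeff L F G := by
  induction L generalizing F G with
  | nil => simp [mulCoeff]; ring
  | cons ℓ L ih =>
    have h : legDeriv ℓ (z • G) = z • legDeriv ℓ G := rfl
    simp only [mulCoeff, h, ih]; ring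

/-- The product of functionals as a bilinear map. -/
def opMulₗ : Func κ ω η ν →ₗ[ℂ] Func κ ω η ν →ₗ[ℂ] Func κ ω η ν :=
  LinearMap.mk₂ ℂ opMul (fun _ _ _ => funext fun _ => mulCoeff_add_left _ _ _ _)
    (fun _ _ _ => funext fun _ => mulCoeff_smul_left _ _ _ _)
    (fun _ _ _ => funext fun _ => mulCoeff_add_right _ _ _ _)
    (fun _ _ _ => funext fun _ => mulCoeff_smul_right _ _ _ _)

theorem add_opMul (F F' G : Func κ ω η ν) : (F + F') ⊠ G = F ⊠ G + F' ⊠ G :=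
  LinearMap.map_add₂ opMulₗ F F' G

theorem opMul_add (F G G' : Func κ ω η ν) : F ⊠ (G + G') = F ⊠ G + F ⊠ G' :=
  map_add (opMulₗ F) G G'

theorem smul_opMul (z : ℂ) (F G : Func κ ω η ν) : (z • F) ⊠ G = z • (F ⊠ G) :=
  LinearMap.map_smul₂ opMulₗ z F G

theorem opMul_smul (z : ℂ) (F G : Func κ ω η ν) : F ⊠ (z • G) = z • (F ⊠ G) :=
  map_smul (opMulₗ F) z G

theorem neg_opMul (F G : Func κ ω η ν) : (-F) ⊠ G = -(F ⊠ G) :=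
  LinearMap.map_neg₂ opMulₗ F G

theorem opMul_neg (F G : Func κ ω η ν) : F ⊠ (-G) = -(F ⊠ G) :=
  map_neg (opMulₗ F) G

theorem zero_opMul (G : Func κ ω η ν) : 0 ⊠ G = 0 := LinearMap.map_zero₂ opMulₗ G

theorem opMul_zero (F : Func κ ω η ν) : F ⊠ 0 = 0 := map_zero (opMulₗ F)

theorem sum_opMul {ι : Type*} (s : Finset ι) (F : ι → Func κ ω η ν) (G : Func κ ω η ν) :
    (∑ i ∈ s, F i) ⊠ G = ∑ i ∈ s, F i ⊠ G :=
  LinearMap.map_sum₂ opMulₗ s F G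

theorem opMul_sum {ι : Type*} (s : Finset ι) (F : Func κ ω η ν) (G : ι → Func κ ω η ν) :
    F ⊠ (∑ i ∈ s, G i) = ∑ i ∈ s, F ⊠ G i :=
  map_sum (opMulₗ F) G s

theorem opOne_opMul (G : Func κ ω η ν) : opOne ⊠ G = G := by
  funext L
  change mulCoeff L opOne G = G L
  induction L generalizing G with
  | nil => simp [mulCoeff, opOne]
  | cons ℓ L ih =>
    have h : legDeriv ℓ (opOne : Func κ ω η ν) = 0 := rfl
    have h' : passSign ℓ (opOne : Func κ ω η ν) = opOne := by
      funext K; cases K <;> simp [passSign, opOne]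
    have h0 : mulCoeff L 0 G = 0 := congrFun (zero_opMul G) L
    rw [mulCoeff, h, h', h0, ih, zero_add]; rfl

theorem opMul_opOne (F : Func κ ω η ν) : F ⊠ opOne = F := by
  funext L
  change mulCoeff L F opOne = F L
  induction L generalizing F with
  | nil => simp [mulCoeff, opOne]
  | cons ℓ L ih =>
    have h : legDeriv ℓ (opOne : Func κ ω η ν) = 0 := rfl
    have h0 : mulCoeff L (passSign ℓ F) 0 = 0 := congrFun (opMul_zero (passSign ℓ F)) L
    rw [mulCoeff, h, h0, ih, add_zero]; rfl

theorem legDeriv_opMul (ℓ : Leg κ ω η ν) (F G : Func κ ω η ν) :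
    legDeriv ℓ (F ⊠ G) = legDeriv ℓ F ⊠ G + passSign ℓ F ⊠ legDeriv ℓ G := rfl

theorem legDeriv_opMul_of_even {ℓ : Leg κ ω η ν} (h : ℓ.field.isOdd = false)
    (F G : Func κ ω η ν) :
    legDeriv ℓ (F ⊠ G) = legDeriv ℓ F ⊠ G + F ⊠ legDeriv ℓ G := by
  rw [legDeriv_opMul, passSign_of_even h]

/-- The sign of `passSign ℓ` counts the odd legs still to come. Differentiating by `k` first removes
`k` from that count, which costs a sign exactly when `ℓ` and `k` are both odd. -/
theorem legDeriv_passSign (ℓ k : Leg κ ω η ν) (F : Func κ ω η ν) :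
    legDeriv k (passSign ℓ F) =
      (if ℓ.field.isOdd ∧ k.field.isOdd then -1 else 1 : ℂ) • passSign ℓ (legDeriv k F) := by
  funext L
  simp only [legDeriv, passSign, List.countP_cons, Pi.smul_apply, smul_eq_mul]
  cases ℓ.field.isOdd <;> cases k.field.isOdd <;>
    by_cases h : Odd (L.countP fun k => k.field.isOdd) <;> simp [h, Nat.odd_add_one]

/-- The space-time derivative as a linear map. -/
noncomputable def pdₗ (μ : Fin 4) : Func κ ω η ν →ₗ[ℂ] Func κ ω η ν where
  toFun := pd μ
  map_add' F G := by funext L; simp [pd, mul_add]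
  map_smul' z F := by funext L; simp only [pd, Pi.smul_apply, smul_eq_mul, RingHom.id_apply]; ring

theorem pdₗ_apply (μ : Fin 4) (F : Func κ ω η ν) : pdₗ μ F = pd μ F := rfl

/-- A product vanishes on all lists of legs with a given property if its first factor does. -/
theorem mulCoeff_eq_zero_of_left {P : Leg κ ω η ν → Prop} {F : Func κ ω η ν}
    (hF : ∀ L, (∀ ℓ ∈ L, P ℓ) → F L = 0) (G : Func κ ω η ν) {L : List (Leg κ ω η ν)}
    (hL : ∀ ℓ ∈ L, P ℓ) : (F ⊠ G) L = 0 := by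
  change mulCoeff L F G = 0
  induction L generalizing F G with
  | nil => simp [mulCoeff, hF [] (by simp)]
  | cons ℓ L ih =>
    have hL' : ∀ k ∈ L, P k := fun k hk => hL k (List.mem_cons_of_mem _ hk)
    rw [mulCoeff, ih _ _ hL', ih _ _ hL', add_zero]
    · intro K hK; simp [passSign, hF K hK]
    · intro K hK
      refine hF _ fun k hk => ?_
      rcases List.mem_cons.1 hk with rfl | hk
      · exact hL _ (by simp)
      · exact hK k hk

/-- A product vanishes on all lists with a leg of a given kind if both factors do. -/
theorem mulCoeff_eq_zero_of_mem {P : Leg κ ω η ν → Prop} (F G : Func κ ω η ν)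
    (hF : ∀ L, (∃ ℓ ∈ L, P ℓ) → F L = 0) (hG : ∀ L, (∃ ℓ ∈ L, P ℓ) → G L = 0)
    (L : List (Leg κ ω η ν)) (hL : ∃ ℓ ∈ L, P ℓ) : mulCoeff L F G = 0 := by
  induction L generalizing F G with
  | nil => simp at hL
  | cons ℓ L ih =>
    have hd : ∀ (H : Func κ ω η ν), (∀ L, (∃ ℓ ∈ L, P ℓ) → H L = 0) →
        ∀ L, (∃ ℓ ∈ L, P ℓ) → legDeriv ℓ H L = 0 := fun H hH K ⟨k, hk, hP⟩ =>
      hH _ ⟨k, List.mem_cons_of_mem _ hk, hP⟩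
    have hp : ∀ L, (∃ ℓ ∈ L, P ℓ) → passSign ℓ F L = 0 := fun K hK => by
      simp [passSign, hF K hK]
    rw [mulCoeff]
    by_cases h : ∃ k ∈ L, P k
    · rw [ih _ _ (hd F hF) hG h, ih _ _ hp (hd G hG) h, add_zero]
    · obtain ⟨k, hk, hP⟩ := hL
      have hk : k = ℓ := (List.mem_cons.1 hk).resolve_right fun hk => h ⟨k, hk, hP⟩
      subst hk
      -- The only marked leg is the one differentiated first, so both factors already have
      -- derivative zero and no induction is needed.
      have hz : ∀ (H : Func κ ω η ν), (∀ L, (∃ ℓ ∈ L, P ℓ) → H L = 0) → legDeriv k H = 0 :=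
        fun H hH => funext fun K => hH _ ⟨k, by simp, hP⟩
      have h1 := congrFun (zero_opMul G) L
      have h2 := congrFun (opMul_zero (passSign k F)) L
      rw [hz F hF, hz G hG]
      exact (congrArg₂ (· + ·) h1 h2).trans (add_zero 0)

/-- A functional whose derivatives with respect to two commuting fields commute at the front of
the list of legs. -/
def EvenSymm (F : Func κ ω η ν) : Prop :=
  ∀ ℓ₁ ℓ₂ : Leg κ ω η ν, ℓ₁.field.isOdd = false → ℓ₂.field.isOdd = false →
    legDeriv ℓ₁ (legDeriv ℓ₂ F) = legDeriv ℓ₂ (legDeriv ℓ₁ F)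

namespace EvenSymm

theorem add {F G : Func κ ω η ν} (hF : EvenSymm F) (hG : EvenSymm G) : EvenSymm (F + G) :=
  fun ℓ₁ ℓ₂ h₁ h₂ => congrArg₂ (· + ·) (hF ℓ₁ ℓ₂ h₁ h₂) (hG ℓ₁ ℓ₂ h₁ h₂)

theorem smul {F : Func κ ω η ν} (hF : EvenSymm F) (z : ℂ) : EvenSymm (z • F) :=
  fun ℓ₁ ℓ₂ h₁ h₂ => congrArg (z • ·) (hF ℓ₁ ℓ₂ h₁ h₂)

theorem opMul {F G : Func κ ω η ν} (hF : EvenSymm F) (hG : EvenSymm G) : EvenSymm (F ⊠ G) := by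
  intro ℓ₁ ℓ₂ h₁ h₂
  have hadd : ∀ (ℓ : Leg κ ω η ν) (A B : Func κ ω η ν),
    legDeriv ℓ (A + B) = legDeriv ℓ A + legDeriv ℓ B := fun _ _ _ => rfl
  simp only [legDeriv_opMul_of_even h₁, legDeriv_opMul_of_even h₂, hadd, hF ℓ₁ ℓ₂ h₁ h₂,
    hG ℓ₁ ℓ₂ h₁ h₂]
  abel

theorem pd {F : Func κ ω η ν} (hF : EvenSymm F) (μ : Fin 4) : EvenSymm (pd μ F) := by
  intro ℓ₁ ℓ₂ h₁ h₂
  funext L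
  have h : F (ℓ₂ :: ℓ₁ :: L) = F (ℓ₁ :: ℓ₂ :: L) := congrFun (hF ℓ₁ ℓ₂ h₁ h₂) L
  simp only [legDeriv, SBGT.pd, h, totalMom, List.map_cons, List.sum_cons, Pi.add_apply]
  rw [add_left_comm]

theorem basic [DecidableEq κ] [DecidableEq ω] [DecidableEq η] [DecidableEq ν]
    (Ψ : ClField κ ω η ν) : EvenSymm (basic Ψ) :=
  fun _ _ _ _ => funext fun _ => rfl

theorem opOne : EvenSymm (opOne : Func κ ω η ν) :=
  fun _ _ _ _ => rfl

end EvenSymm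

end FunctionalAlgebra

/-! ### Infinitesimal gauge transformations as derivations -/

namespace BrokenGaugeTheory

variable {κ ω η ν : Type*} [Fintype κ] [Fintype ω] [Fintype η] [Fintype ν]
  [DecidableEq κ] [DecidableEq ω]

section MassGold

variable (M : BrokenGaugeTheory κ ω η ν) (a : κ ⊕ ω)

theorem massGold_add {E : Type*} [AddCommGroup E] [Module ℝ E] (X Y : κ → E) :
    M.massGold a (fun α => X α + Y α) = M.massGold a X + M.massGold a Y := by
  cases a <;> simp [massGold]

theorem massGold_zero {E : Type*} [AddCommGroup E] [Module ℝ E] :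
    M.massGold a (fun _ => (0 : E)) = 0 := by
  cases a <;> simp [massGold]

theorem massGold_map {E E' : Type*} [AddCommGroup E] [Module ℝ E] [AddCommGroup E'] [Module ℝ E']
    (g : E →ₗ[ℝ] E') (X : κ → E) : M.massGold a (fun α => g (X α)) = g (M.massGold a X) := by
  cases a <;> simp [massGold]

theorem massGold_mul_left (z : ℂ) (X : κ → ℂ) :
    M.massGold a (fun α => z * X α) = z * M.massGold a X :=
  M.massGold_map a (LinearMap.mulLeft ℝ z) X

theorem massGold_mul_right (z : ℂ) (X : κ → ℂ) :
    M.massGold a (fun α => X α * z) = M.massGold a X * z :=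
  M.massGold_map a (LinearMap.mulRight ℝ z) X

theorem massGold_neg (X : κ → ℂ) :
    M.massGold a (fun α => -X α) = -M.massGold a X := by
  cases a <;> simp [massGold]

theorem massGold_sum {ι : Type*} (s : Finset ι) (X : ι → κ → ℂ) :
    M.massGold a (fun α => ∑ i ∈ s, X i α) = ∑ i ∈ s, M.massGold a (X i) := by
  cases a <;> simp [massGold, Finset.mul_sum]

theorem massGold_apply (X : κ → Func κ ω η ν) (L : List (Leg κ ω η ν)) :
    M.massGold a X L = M.massGold a fun α => X α L := by
  cases a <;> simp [massGold]

end MassGold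

variable (M : BrokenGaugeTheory κ ω η ν) (b : κ ⊕ ω) (p : Momentum)

theorem contr_apply (F : Func κ ω η ν) (L : List (Leg κ ω η ν)) :
    M.contr b p F L = -(I * ∑ μ, (p μ : ℂ) * F (⟨.fld (.W b μ), p⟩ :: L))
      - M.massGold b fun α => F (⟨.fld (.scal (Sum.inl α)), p⟩ :: L) := by
  simp only [contr, Pi.sub_apply, Pi.neg_apply, Pi.smul_apply, smul_eq_mul, Finset.sum_apply,
    massGold_apply, legDeriv]

/-- `𝒟_b(p)` as a linear map. -/
noncomputable def contrₗ : Func κ ω η ν →ₗ[ℂ] Func κ ω η ν where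
  toFun := M.contr b p
  map_add' F G := by
    funext L
    simp only [contr_apply, Pi.add_apply, massGold_add, mul_add, Finset.sum_add_distrib]
    ring
  map_smul' z F := by
    funext L
    simp only [contr_apply, Pi.smul_apply, smul_eq_mul, massGold_mul_left, RingHom.id_apply,
      mul_left_comm _ z, ← Finset.mul_sum]
    ring

theorem contrₗ_apply (F : Func κ ω η ν) : M.contrₗ b p F = M.contr b p F := rfl

/-- The Leibniz rule for `𝒟_b(p)`. -/
theorem contr_opMul (F G : Func κ ω η ν) :
    M.contr b p (F ⊠ G) = M.contr b p F ⊠ G + F ⊠ M.contr b p G := by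
  have hW : ∀ μ, legDeriv (⟨.fld (.W b μ), p⟩ : Leg κ ω η ν) (F ⊠ G) = _ := fun μ =>
    legDeriv_opMul_of_even rfl F G
  have hφ : ∀ α, legDeriv (⟨.fld (.scal (Sum.inl α)), p⟩ : Leg κ ω η ν) (F ⊠ G) = _ := fun α =>
    legDeriv_opMul_of_even rfl F G
  simp only [contr, hW, hφ]
  -- The mass term is a real multiple of a single derivative, or zero for an unbroken generator, so
  -- the Leibniz rule passes through it.
  have hm : ∀ X Y : κ → Func κ ω η ν, M.massGold b (fun α => X α ⊠ G + F ⊠ Y α)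
      = M.massGold b X ⊠ G + F ⊠ M.massGold b Y := by
    intro X Y
    cases b with
    | inl α =>
      simp only [massGold, ← Complex.coe_smul, smul_add, smul_opMul, opMul_smul]
    | inr _ => simp only [massGold, zero_opMul, opMul_zero, add_zero]
  rw [hm, sub_eq_add_neg, sub_eq_add_neg, sub_eq_add_neg, add_opMul, opMul_add]
  simp only [smul_add, Finset.sum_add_distrib, neg_opMul, opMul_neg, smul_opMul, opMul_smul,
    sum_opMul, opMul_sum]
  abel

/-- The coefficient `T^b_{Φ'Ψ}` for an arbitrary field `Ψ`; it is zero for ghosts and sources. -/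
noncomputable def legMatrix (Φ' : Fld κ ω η ν) : ClField κ ω η ν → ℂ
  | .fld Φ => M.brsMatrix b Φ' Φ
  | _ => 0

/-- The homogeneous part of an infinitesimal gauge transformation: every leg in turn is
transformed, and its momentum is shifted by `p`. -/
noncomputable def rotCoeff : List (Leg κ ω η ν) → Func κ ω η ν → ℂ
  | [], _ => 0
  | ℓ :: L, F => ∑ Φ', M.legMatrix b Φ' ℓ.field * F (⟨.fld Φ', p + ℓ.mom⟩ :: L)
      + rotCoeff L (legDeriv ℓ F)

theorem rotCoeff_add (L : List (Leg κ ω η ν)) (F G : Func κ ω η ν) :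
    M.rotCoeff b p L (F + G) = M.rotCoeff b p L F + M.rotCoeff b p L G := by
  induction L generalizing F G with
  | nil => simp [rotCoeff]
  | cons ℓ L ih =>
    have h : legDeriv ℓ (F + G) = legDeriv ℓ F + legDeriv ℓ G := rfl
    simp only [rotCoeff, h, ih, Pi.add_apply, mul_add, Finset.sum_add_distrib]; ring

theorem rotCoeff_smul (L : List (Leg κ ω η ν)) (z : ℂ) (F : Func κ ω η ν) :
    M.rotCoeff b p L (z • F) = z * M.rotCoeff b p L F := by
  induction L generalizing F with
  | nil => simp [rotCoeff]
  | cons ℓ L ih =>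
    have h : legDeriv ℓ (z • F) = z • legDeriv ℓ F := rfl
    simp only [rotCoeff, h, ih, Pi.smul_apply, smul_eq_mul, mul_add, Finset.mul_sum]
    congr 1
    exact Finset.sum_congr rfl fun _ _ => by ring

/-- The homogeneous part of an infinitesimal gauge transformation as a linear map. -/
noncomputable def rot : Func κ ω η ν →ₗ[ℂ] Func κ ω η ν where
  toFun F L := M.rotCoeff b p L F
  map_add' F G := funext fun L => M.rotCoeff_add b p L F G
  map_smul' z F := funext fun L => M.rotCoeff_smul b p L z F

theorem rot_nil (F : Func κ ω η ν) : M.rot b p F [] = 0 := rfl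

theorem rot_cons (F : Func κ ω η ν) (ℓ : Leg κ ω η ν) (L : List (Leg κ ω η ν)) :
    M.rot b p F (ℓ :: L) =
      ∑ Φ', M.legMatrix b Φ' ℓ.field * F (⟨.fld Φ', p + ℓ.mom⟩ :: L)
        + M.rot b p (legDeriv ℓ F) L := rfl

theorem legDeriv_rot (F : Func κ ω η ν) (ℓ : Leg κ ω η ν) :
    legDeriv ℓ (M.rot b p F) =
      ∑ Φ', M.legMatrix b Φ' ℓ.field • legDeriv ⟨.fld Φ', p + ℓ.mom⟩ F
        + M.rot b p (legDeriv ℓ F) := by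
  funext L
  simp only [legDeriv, rot_cons, Pi.add_apply, Finset.sum_apply, Pi.smul_apply, smul_eq_mul]

/-- Gauge transformations do not mix commuting with anticommuting fields. -/
theorem isOdd_eq_of_legMatrix_ne_zero {Φ' : Fld κ ω η ν} {Ψ : ClField κ ω η ν}
    (h : M.legMatrix b Φ' Ψ ≠ 0) : (ClField.fld Φ').isOdd = Ψ.isOdd := by
  rcases Ψ with Φ | _ | _ | _ | _
  · rcases Φ with _ | _ | _ | _ <;> rcases Φ' with _ | _ | _ | _ <;>
      simp_all [legMatrix, brsMatrix, ClField.isOdd]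
  all_goals exact absurd rfl h

/-- Where the coefficient is nonzero, the rotated leg has the statistics of the original one, so
both produce the same sign. This is what makes `rot` obey an unsigned Leibniz rule. -/
theorem legMatrix_smul_passSign (Φ' : Fld κ ω η ν) (ℓ : Leg κ ω η ν) (F : Func κ ω η ν)
    (q : Momentum) :
    M.legMatrix b Φ' ℓ.field • passSign ⟨.fld Φ', q⟩ F =
      M.legMatrix b Φ' ℓ.field • passSign ℓ F := by
  by_cases h : M.legMatrix b Φ' ℓ.field = 0
  · simp [h]
  · unfold passSign
    simp only [M.isOdd_eq_of_legMatrix_ne_zero b h]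

/-- Rotating legs does not change how many of them are odd. -/
theorem rot_passSign (ℓ : Leg κ ω η ν) (F : Func κ ω η ν) :
    M.rot b p (passSign ℓ F) = passSign ℓ (M.rot b p F) := by
  funext L
  induction L generalizing F with
  | nil => simp [rot_nil, passSign]
  | cons k L ih =>
    have h : ∀ Φ', M.legMatrix b Φ' k.field * passSign ℓ F (⟨.fld Φ', p + k.mom⟩ :: L) =
        (if ℓ.field.isOdd ∧ k.field.isOdd then -1 else 1 : ℂ) * (M.legMatrix b Φ' k.field *
          passSign ℓ (legDeriv ⟨.fld Φ', p + k.mom⟩ F) L) := by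
      intro Φ'
      by_cases h : M.legMatrix b Φ' k.field = 0
      · simp [h]
      · have := congrFun (legDeriv_passSign ℓ ⟨.fld Φ', p + k.mom⟩ F) L
        simp only [M.isOdd_eq_of_legMatrix_ne_zero b h, Pi.smul_apply, smul_eq_mul] at this
        rw [← mul_left_comm, ← this]; rfl
    have h' := congrFun (legDeriv_passSign ℓ k (M.rot b p F)) L
    change passSign ℓ (M.rot b p F) (k :: L) = _ at h'
    rw [h', rot_cons, legDeriv_passSign, map_smul, legDeriv_rot]
    simp only [h, Pi.smul_apply, smul_eq_mul, ih, ← Finset.mul_sum, ← mul_add]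
    congr 1
    simp only [passSign, Pi.add_apply, Finset.sum_apply, Pi.smul_apply, smul_eq_mul, mul_add,
      Finset.mul_sum]
    congr 1
    exact Finset.sum_congr rfl fun _ _ => mul_left_comm _ _ _

/-- The Leibniz rule for homogeneous gauge transformations. -/
theorem rot_opMul (F G : Func κ ω η ν) :
    M.rot b p (F ⊠ G) = M.rot b p F ⊠ G + F ⊠ M.rot b p G := by
  funext L
  induction L generalizing F G with
  | nil => simp [rot_nil, opMul, mulCoeff]
  | cons ℓ L ih =>
    have hl : ∀ H K : Func κ ω η ν, (H ⊠ K) (ℓ :: L) =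
        (legDeriv ℓ H ⊠ K) L + (passSign ℓ H ⊠ legDeriv ℓ K) L := fun _ _ => rfl
    have hs : ∀ Φ', M.legMatrix b Φ' ℓ.field * (F ⊠ G) (⟨.fld Φ', p + ℓ.mom⟩ :: L) =
        ((M.legMatrix b Φ' ℓ.field • legDeriv ⟨.fld Φ', p + ℓ.mom⟩ F) ⊠ G) L +
        (passSign ℓ F ⊠ (M.legMatrix b Φ' ℓ.field • legDeriv ⟨.fld Φ', p + ℓ.mom⟩ G)) L := by
      intro Φ'
      have : (F ⊠ G) (⟨.fld Φ', p + ℓ.mom⟩ :: L) = (legDeriv ⟨.fld Φ', p + ℓ.mom⟩ F ⊠ G) L +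
        (passSign ⟨.fld Φ', p + ℓ.mom⟩ F ⊠ legDeriv ⟨.fld Φ', p + ℓ.mom⟩ G) L := rfl
      rw [this, opMul_smul, ← smul_opMul _ (passSign ℓ F),
        ← M.legMatrix_smul_passSign b Φ' ℓ F (p + ℓ.mom),
        smul_opMul, smul_opMul]
      simp only [Pi.smul_apply, smul_eq_mul, mul_add]
    rw [rot_cons, legDeriv_opMul, map_add, Pi.add_apply, ih, ih]
    simp only [hl, hs, legDeriv_rot, rot_passSign, add_opMul, opMul_add, sum_opMul, opMul_sum,
      Pi.add_apply, Finset.sum_apply, Finset.sum_add_distrib]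
    ring

/-- Space-time derivatives and homogeneous gauge transformations. -/
theorem rot_pd (F : Func κ ω η ν) (μ : Fin 4) :
    M.rot b p (pd μ F) = pd μ (M.rot b p F) - (I * (p μ : ℂ)) • M.rot b p F := by
  -- Peeling off a leg of momentum `k` turns `∂_μ` into multiplication by the momentum of the
  -- remaining legs plus `k`. The offset `q` collects the legs already peeled off and makes the
  -- induction close.
  have key : ∀ (L : List (Leg κ ω η ν)) (q : Momentum) (F : Func κ ω η ν),
      M.rot b p (fun K => -I * ((q + totalMom K) μ : ℝ) * F K) L =
        -I * ((q + p + totalMom L) μ : ℝ) * M.rot b p F L := by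
    intro L
    induction L with
    | nil => intro q F; simp [rot_nil]
    | cons ℓ L ih =>
      intro q F
      have h : legDeriv ℓ (fun K => -I * ((q + totalMom K) μ : ℝ) * F K) =
          fun K => -I * (((q + ℓ.mom) + totalMom K) μ : ℝ) * legDeriv ℓ F K := by
        funext K
        simp only [legDeriv, totalMom, List.map_cons, List.sum_cons, add_assoc]
      rw [rot_cons, h, ih, rot_cons, mul_add, Finset.mul_sum]
      congr 1
      · refine Finset.sum_congr rfl fun Φ' _ => ?_
        simp only [totalMom, List.map_cons, List.sum_cons, Pi.add_apply]
        push_cast; ring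
      · simp only [totalMom, List.map_cons, List.sum_cons, Pi.add_apply]
        push_cast; ring
  funext L
  have h := key L 0 F
  simp only [zero_add] at h
  have h' : (pd μ F) = fun K => -I * (totalMom K μ : ℂ) * F K := rfl
  rw [h', h]
  simp only [pd, Pi.sub_apply, Pi.smul_apply, smul_eq_mul, Pi.add_apply]
  push_cast; ring

/-- The inner derivative also sees the momentum `p` of the contracted leg. The correction is the
derivative of the plane wave parameter, as for `rot`. -/
theorem contr_pd (F : Func κ ω η ν) (μ : Fin 4) :
    M.contr b p (pd μ F) = pd μ (M.contr b p F) - (I * (p μ : ℂ)) • M.contr b p F := by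
  funext L
  simp only [contr_apply, pd, totalMom, List.map_cons, List.sum_cons, Pi.sub_apply, Pi.smul_apply,
    smul_eq_mul, Pi.add_apply, massGold_mul_left, mul_left_comm _ (-I * _), ← Finset.mul_sum]
  push_cast; ring

/-- An infinitesimal gauge transformation in the direction of the generator `b`, with a plane wave
of momentum `p` as parameter. -/
noncomputable def gaugeVar : Func κ ω η ν →ₗ[ℂ] Func κ ω η ν := M.contrₗ b p + M.rot b p

theorem gaugeVar_eq (F : Func κ ω η ν) : M.gaugeVar b p F = M.contr b p F + M.rot b p F := rfl

theorem gaugeVar_opMul (F G : Func κ ω η ν) :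
    M.gaugeVar b p (F ⊠ G) = M.gaugeVar b p F ⊠ G + F ⊠ M.gaugeVar b p G := by
  simp only [gaugeVar_eq, contr_opMul, rot_opMul, add_opMul, opMul_add]
  abel

theorem gaugeVar_pd (F : Func κ ω η ν) (μ : Fin 4) :
    M.gaugeVar b p (pd μ F) =
      pd μ (M.gaugeVar b p F) - (I * (p μ : ℂ)) • M.gaugeVar b p F := by
  have h : ∀ A B : Func κ ω η ν, pd μ (A + B) = pd μ A + pd μ B := (pdₗ μ).map_add
  simp only [gaugeVar_eq, contr_pd, rot_pd, h, smul_add]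
  abel

theorem gaugeVar_opOne : M.gaugeVar b p (opOne : Func κ ω η ν) = 0 := by
  have h : ∀ L, M.rot b p (opOne : Func κ ω η ν) L = 0 := by
    intro L
    cases L with
    | nil => rfl
    | cons ℓ L =>
      have : legDeriv ℓ (opOne : Func κ ω η ν) = 0 := rfl
      rw [rot_cons, this, map_zero]
      simp [opOne]
  funext L
  simp [gaugeVar_eq, h, contr_apply, opOne, massGold_zero]

/-- The inhomogeneous part of the infinitesimal gauge transformation of a field. -/
noncomputable def gaugeShift : Fld κ ω η ν → ℂ
  | .W a μ => if a = b then -(I * (p μ : ℂ)) else 0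
  | .scal A => -((∑ j, M.T b A (Sum.inr j) * M.v j : ℝ) : ℂ)
  | _ => 0

variable [DecidableEq η] [DecidableEq ν]

/-- For scalars this is where the vacuum conditions enter: `T^b v` has only the component `m_b` in
the direction of `φ_b`, so the shift generated by `𝒟_b` is that of the gauge transformation of the
vacuum. -/
theorem contr_basic_nil (Φ : Fld κ ω η ν) :
    M.contr b p (basic (.fld Φ)) [] = M.gaugeShift b p Φ := by
  rw [contr_apply]
  rcases Φ with ⟨a, ρ⟩ | A | _ | _
  · simp only [basic, gaugeShift, ClField.fld.injEq, Fld.W.injEq, reduceCtorEq, if_false,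
      massGold_zero]
    by_cases h : b = a
    · subst h; simp
    · simp [h, Ne.symm h]
  · simp only [basic, gaugeShift, ClField.fld.injEq, Fld.scal.injEq, reduceCtorEq, if_false]
    rcases A with α | i
    · rw [M.vac_gold]
      rcases b with β | β
      · by_cases h : β = α
        · subst h; simp [massGold]
        · simp [massGold, h]
      · simp [massGold]
    · rw [M.vac_higgs]; simp [massGold_zero]
  · simp [basic, gaugeShift, massGold_zero]
  · simp [basic, gaugeShift, massGold_zero]

/-- The infinitesimal gauge transformation of a field. -/
theorem gaugeVar_basic (Φ : Fld κ ω η ν) :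
    M.gaugeVar b p (basic (.fld Φ)) =
      M.gaugeShift b p Φ • opOne + ∑ Φ', M.brsMatrix b Φ Φ' • basic (.fld Φ') := by
  funext L
  rw [gaugeVar_eq]
  simp only [Pi.add_apply, Finset.sum_apply, Pi.smul_apply, smul_eq_mul]
  rcases L with _ | ⟨ℓ, _ | ⟨k, L⟩⟩
  · simp [contr_basic_nil, rot_nil, opOne, basic]
  · have h : M.contr b p (basic (.fld Φ)) [ℓ] = 0 := by
      rw [contr_apply]; simp [basic, massGold_zero]
    rw [h, rot_cons, rot_nil]
    simp only [opOne, basic, mul_zero, zero_add, add_zero, ClField.fld.injEq]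
    rw [Finset.sum_eq_single Φ (by simp +contextual) (by simp)]
    rcases ℓ with ⟨Ψ | _ | _ | _ | _, q⟩
    · simp [legMatrix]
    all_goals simp [legMatrix]
  · have h : M.contr b p (basic (.fld Φ)) (ℓ :: k :: L) = 0 := by
      rw [contr_apply]; simp [basic, massGold_zero]
    have h0 : legDeriv k (legDeriv ℓ (basic (.fld Φ) : Func κ ω η ν)) = 0 := by
      funext K; simp [legDeriv, basic]
    rw [h, rot_cons, rot_cons, h0, map_zero]
    simp [legDeriv, basic, opOne]

end BrokenGaugeTheory

/-! ### Covariant multiplets, covariant derivatives and the field strength -/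

theorem sum_fld {κ ω η ν : Type*} [Fintype κ] [Fintype ω] [Fintype η] [Fintype ν]
    {E : Type*} [AddCommMonoid E] (g : Fld κ ω η ν → E) :
    ∑ Φ, g Φ = ∑ a, ∑ μ, g (.W a μ) + ∑ A, g (.scal A) + ∑ i, ∑ s, g (.psi i s)
      + ∑ i, ∑ s, g (.psibar i s) := by
  let e : (((κ ⊕ ω) × Fin 4) ⊕ (κ ⊕ η)) ⊕ ((ν × Fin 4) ⊕ (ν × Fin 4)) ≃ Fld κ ω η ν :=
    { toFun := fun x => match x with
        | .inl (.inl x) => .W x.1 x.2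
        | .inl (.inr A) => .scal A
        | .inr (.inl x) => .psi x.1 x.2
        | .inr (.inr x) => .psibar x.1 x.2
      invFun := fun Φ => match Φ with
        | .W a μ => .inl (.inl (a, μ))
        | .scal A => .inl (.inr A)
        | .psi i s => .inr (.inl (i, s))
        | .psibar i s => .inr (.inr (i, s))
      left_inv := by rintro ((_ | _) | (_ | _)) <;> rfl
      right_inv := by rintro (_ | _ | _ | _) <;> rfl }
  rw [← e.sum_comp]
  simp only [Fintype.sum_sum_type (α₁ := (((κ ⊕ ω) × Fin 4) ⊕ (κ ⊕ η))),
    Fintype.sum_sum_type (α₁ := ((κ ⊕ ω) × Fin 4)), Fintype.sum_sum_type (α₁ := (ν × Fin 4)),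
    Fintype.sum_prod_type, add_assoc]
  rfl

namespace BrokenGaugeTheory

variable {κ ω η ν : Type*} [Fintype κ] [Fintype ω] [Fintype η] [Fintype ν]
  [DecidableEq κ] [DecidableEq ω]

variable (M : BrokenGaugeTheory κ ω η ν) (b : κ ⊕ ω) (p : Momentum)

section Multiplets

variable {ι ι' : Type*} [Fintype ι] [Fintype ι']

/-- The functionals `F i` transform homogeneously under gauge transformations. -/
def Covariant (R : Matrix ι ι ℂ) (F : ι → Func κ ω η ν) : Prop :=
  ∀ i, M.gaugeVar b p (F i) = ∑ j, R i j • F j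

variable {M b p}

/-- A product of multiplets transforms in the tensor product representation, whose generator is the
Kronecker sum. -/
theorem Covariant.opMul [DecidableEq ι] [DecidableEq ι'] {R : Matrix ι ι ℂ}
    {S : Matrix ι' ι' ℂ} {F : ι → Func κ ω η ν} {G : ι' → Func κ ω η ν}
    (hF : M.Covariant b p R F) (hG : M.Covariant b p S G) :
    M.Covariant b p (fun x y => R x.1 y.1 * (1 : Matrix ι' ι' ℂ) x.2 y.2
        + (1 : Matrix ι ι ℂ) x.1 y.1 * S x.2 y.2)
      (fun x : ι × ι' => F x.1 ⊠ G x.2) := by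
  rintro ⟨i, k⟩
  rw [gaugeVar_opMul, hF, hG]
  simp only [sum_opMul, opMul_sum, smul_opMul, opMul_smul, Fintype.sum_prod_type, add_smul,
    Finset.sum_add_distrib, Matrix.one_apply, mul_ite, ite_mul, mul_one, one_mul, mul_zero,
    zero_mul, ite_smul, zero_smul, Finset.sum_ite_eq, Finset.mem_univ, if_true]
  congr 1
  rw [Finset.sum_comm]
  simp

theorem Covariant.gaugeVar_sum_smul {R : Matrix ι ι ℂ} {F : ι → Func κ ω η ν}
    (hF : M.Covariant b p R F) {c : ι → ℂ} (hc : ∀ j, ∑ i, c i * R i j = 0) :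
    M.gaugeVar b p (∑ i, c i • F i) = 0 := by
  simp only [map_sum, map_smul, hF _, Finset.smul_sum, smul_smul]
  rw [Finset.sum_comm]
  simp only [← Finset.sum_smul, hc, zero_smul, Finset.sum_const_zero]

/-- Antisymmetric generators preserve the Euclidean square. This covers the Yang-Mills term and the
scalar kinetic term. -/
theorem Covariant.gaugeVar_sum_opMul_self {R : Matrix ι ι ℂ} {F : ι → Func κ ω η ν}
    (hF : M.Covariant b p R F) (hR : ∀ i j, R j i = -R i j) :
    M.gaugeVar b p (∑ i, F i ⊠ F i) = 0 := by
  simp only [map_sum, gaugeVar_opMul, hF _, sum_opMul, opMul_sum, smul_opMul, opMul_smul,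
    Finset.sum_add_distrib]
  rw [Finset.sum_comm, ← Finset.sum_add_distrib]
  refine Finset.sum_eq_zero fun i _ => ?_
  rw [← Finset.sum_add_distrib]
  refine Finset.sum_eq_zero fun j _ => ?_
  rw [hR i j, neg_smul, neg_add_cancel]

theorem sum_mul_kroneckerSum [DecidableEq ι] [DecidableEq ι'] (R : Matrix ι ι ℂ)
    (S : Matrix ι' ι' ℂ) (c : ι → ι' → ℂ) (i : ι) (k : ι') :
    ∑ x : ι × ι', c x.1 x.2 * (R x.1 i * (1 : Matrix ι' ι' ℂ) x.2 k
      + (1 : Matrix ι ι ℂ) x.1 i * S x.2 k) = ∑ j, c j k * R j i + ∑ l, c i l * S l k := by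
  simp only [Fintype.sum_prod_type, mul_add, Finset.sum_add_distrib, Matrix.one_apply, mul_ite,
    ite_mul, mul_one, one_mul, mul_zero, zero_mul, Finset.sum_ite_eq', Finset.mem_univ, if_true]
  congr 1
  rw [Finset.sum_comm]
  simp

/-- The hypothesis `hC` says that `C` is an invariant tensor. The versions with three and four
factors below follow by treating the first two factors as one multiplet indexed by pairs. -/
theorem Covariant.gaugeVar_sum_bilin [DecidableEq ι] [DecidableEq ι'] {R : Matrix ι ι ℂ}
    {S : Matrix ι' ι' ℂ} {F : ι → Func κ ω η ν} {G : ι' → Func κ ω η ν}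
    (hF : M.Covariant b p R F) (hG : M.Covariant b p S G) {C : ι → ι' → ℂ}
    (hC : ∀ i k, ∑ j, C j k * R j i + ∑ l, C i l * S l k = 0) :
    M.gaugeVar b p (∑ i, ∑ k, C i k • (F i ⊠ G k)) = 0 := by
  have := (hF.opMul hG).gaugeVar_sum_smul (c := fun x => C x.1 x.2) (by
    rintro ⟨i, k⟩
    rw [← hC i k]
    exact sum_mul_kroneckerSum R S C i k)
  simpa only [Fintype.sum_prod_type] using this

theorem Covariant.gaugeVar_sum_trilin {ι'' : Type*} [Fintype ι''] [DecidableEq ι]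
    [DecidableEq ι'] [DecidableEq ι''] {R : Matrix ι ι ℂ}
    {S : Matrix ι' ι' ℂ} {U : Matrix ι'' ι'' ℂ} {F : ι → Func κ ω η ν} {G : ι' → Func κ ω η ν}
    {H : ι'' → Func κ ω η ν} (hF : M.Covariant b p R F) (hG : M.Covariant b p S G)
    (hH : M.Covariant b p U H) {C : ι → ι' → ι'' → ℂ}
    (hC : ∀ i k l, ∑ j, C j k l * R j i + ∑ j, C i j l * S j k + ∑ j, C i k j * U j l = 0) :
    M.gaugeVar b p (∑ i, ∑ k, ∑ l, C i k l • (F i ⊠ G k ⊠ H l)) = 0 := by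
  have := (hF.opMul hG).gaugeVar_sum_bilin hH (C := fun x l => C x.1 x.2 l) (by
    rintro ⟨i, k⟩ l
    rw [← hC i k l, ← sum_mul_kroneckerSum R S (fun j m => C j m l)])
  simpa only [Fintype.sum_prod_type] using this

theorem Covariant.gaugeVar_sum_quadrilin {ι₃ ι₄ : Type*} [Fintype ι₃] [Fintype ι₄]
    [DecidableEq ι] [DecidableEq ι'] [DecidableEq ι₃] [DecidableEq ι₄] {R : Matrix ι ι ℂ}
    {S : Matrix ι' ι' ℂ} {U : Matrix ι₃ ι₃ ℂ} {V : Matrix ι₄ ι₄ ℂ}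
    {F : ι → Func κ ω η ν} {G : ι' → Func κ ω η ν} {H : ι₃ → Func κ ω η ν}
    {K : ι₄ → Func κ ω η ν} (hF : M.Covariant b p R F) (hG : M.Covariant b p S G)
    (hH : M.Covariant b p U H) (hK : M.Covariant b p V K) {C : ι → ι' → ι₃ → ι₄ → ℂ}
    (hC : ∀ i k l m, ∑ j, C j k l m * R j i + ∑ j, C i j l m * S j k + ∑ j, C i k j m * U j l
      + ∑ j, C i k l j * V j m = 0) :
    M.gaugeVar b p (∑ i, ∑ k, ∑ l, ∑ m, C i k l m • (F i ⊠ G k ⊠ H l ⊠ K m)) = 0 := by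
  have := (hF.opMul hG).gaugeVar_sum_trilin hH hK (C := fun x l m => C x.1 x.2 l m) (by
    rintro ⟨i, k⟩ l m
    rw [← hC i k l m, ← sum_mul_kroneckerSum R S (fun j n => C j n l m)])
  simpa only [Fintype.sum_prod_type] using this

end Multiplets

/-- Structure constants are cyclic. -/
theorem f_cycl (a b c : κ ⊕ ω) : M.f c a b = M.f a b c := by
  rw [M.f_swap_right a c b, M.f_swap_left c a b]; ring

variable [DecidableEq η] [DecidableEq ν]

theorem gaugeVar_fW (a : κ ⊕ ω) (μ : Fin 4) :
    M.gaugeVar b p (M.fW a μ) =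
      (if a = b then -(I * (p μ : ℂ)) else 0) • opOne + ∑ d, (M.f a d b : ℂ) • M.fW d μ := by
  rw [fW, gaugeVar_basic, sum_fld]
  simp [brsMatrix, gaugeShift, fW]

/-- The matrix by which the scalars transform. -/
noncomputable def scalMat (a : κ ⊕ ω) : Matrix (κ ⊕ η) (κ ⊕ η) ℂ :=
  Matrix.of fun A B => -(M.T a A B : ℂ)

/-- The constant `v` is not varied, but the inhomogeneous shift of the scalars equals the rotation
of `v`. The sum therefore transforms homogeneously. -/
theorem covariant_fPhi : M.Covariant b p (M.scalMat b) M.fPhi := by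
  intro A
  simp only [scalMat, Matrix.of_apply]
  rw [fPhi, map_add, map_smul, gaugeVar_opOne, gaugeVar_basic, sum_fld]
  simp only [smul_zero, zero_add, gaugeShift, brsMatrix, zero_smul, Finset.sum_const_zero,
    add_zero, fPhi, smul_add, Finset.sum_add_distrib]
  congr 1
  rw [Fintype.sum_sum_type]
  simp only [Sum.elim_inl, Sum.elim_inr, Pi.zero_apply, Complex.ofReal_zero, zero_smul, smul_zero,
    Finset.sum_const_zero, zero_add, smul_smul, neg_mul, Complex.ofReal_sum, Complex.ofReal_mul,
    neg_smul, Finset.sum_smul, Finset.sum_neg_distrib]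

/-- The matrix `τ_L^a P_L + τ_R^a P_R`. -/
noncomputable def tauMat (a : κ ⊕ ω) : Matrix (ν × Fin 4) (ν × Fin 4) ℂ :=
  Matrix.kronecker (M.τL a) projL + Matrix.kronecker (M.τR a) projR

/-- The matrix `τ_L^a P_R + τ_R^a P_L`. -/
noncomputable def tauMatBar (a : κ ⊕ ω) : Matrix (ν × Fin 4) (ν × Fin 4) ℂ :=
  Matrix.kronecker (M.τL a) projR + Matrix.kronecker (M.τR a) projL

theorem covariant_fpsi :
    M.Covariant b p (I • M.tauMat b) (fun x : ν × Fin 4 => M.fpsi x.1 x.2) := by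
  rintro ⟨i, s⟩
  simp only [fpsi]
  rw [gaugeVar_basic, sum_fld]
  simp [brsMatrix, gaugeShift, tauMat, tauDirac, Fintype.sum_prod_type]

/-- The generator acts on `ψ̄` from the right, hence the transpose. -/
theorem covariant_fpsibar :
    M.Covariant b p (-(I • (M.tauMatBar b).transpose))
      (fun x : ν × Fin 4 => M.fpsibar x.1 x.2) := by
  rintro ⟨i, s⟩
  simp only [fpsibar]
  rw [gaugeVar_basic, sum_fld]
  simp only [brsMatrix, gaugeShift, tauMatBar, tauDiracBar, Fintype.sum_prod_type, zero_smul,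
    Finset.sum_const_zero, zero_add]
  rfl

/-- Covariant derivatives transform like the fields. -/
theorem Covariant.covDeriv {ι : Type*} [Fintype ι] (ρ : κ ⊕ ω → Matrix ι ι ℂ)
    {F : ι → Func κ ω η ν} (hF : M.Covariant b p (ρ b) F)
    (hρ : ∀ a, ρ a * ρ b - ρ b * ρ a = -∑ c, (M.f a b c : ℂ) • ρ c) (μ : Fin 4) :
    M.Covariant b p (ρ b)
      (fun i => pd μ (F i) - ∑ a, ∑ j, ρ a i j • (M.fW a μ ⊠ F j)) := by
  intro i
  have hsum : ∀ (c : ι → ℂ) (G : ι → Func κ ω η ν),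
      pd μ (∑ j, c j • G j) = ∑ j, c j • pd μ (G j) := fun c G => by
    simp only [← pdₗ_apply, map_sum, map_smul]
  have hW : ∀ a j, M.gaugeVar b p (M.fW a μ ⊠ F j) =
      (if a = b then -(I * (p μ : ℂ)) else 0) • F j
        + ∑ d, (M.f a d b : ℂ) • (M.fW d μ ⊠ F j) + ∑ k, ρ b j k • (M.fW a μ ⊠ F k) := by
    intro a j
    rw [gaugeVar_opMul, gaugeVar_fW, hF]
    simp only [add_opMul, smul_opMul, opOne_opMul, sum_opMul, opMul_sum, opMul_smul]
  -- The shift of `W_b` cancels the derivative of the plane wave parameter coming from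
  -- `gaugeVar_pd`.
  have h1 : ∑ a, ∑ j, ρ a i j • (if a = b then -(I * (p μ : ℂ)) else 0) • F j =
      -((I * (p μ : ℂ)) • ∑ j, ρ b i j • F j) := by
    rw [Finset.sum_eq_single b (by intro a _ h; simp [h]) (by simp)]
    simp only [if_true, neg_smul, smul_neg, Finset.sum_neg_distrib, Finset.smul_sum]
    simp only [smul_comm (ρ b i _)]
  have h2 : ∑ a, ∑ j, ρ a i j • ∑ d, (M.f a d b : ℂ) • (M.fW d μ ⊠ F j) =
      ∑ a, ∑ j, (∑ c, (M.f a b c : ℂ) * ρ c i j) • (M.fW a μ ⊠ F j) := by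
    simp only [Finset.smul_sum, smul_smul, Finset.sum_smul]
    rw [Finset.sum_comm]
    conv_rhs => rw [Finset.sum_comm]
    refine Finset.sum_congr rfl fun j _ => ?_
    rw [Finset.sum_comm]
    refine Finset.sum_congr rfl fun d _ => Finset.sum_congr rfl fun c _ => ?_
    rw [M.f_cycl d b c, mul_comm]
  have h3 : ∑ a, ∑ j, ρ a i j • ∑ k, ρ b j k • (M.fW a μ ⊠ F k) =
      ∑ a, ∑ j, (ρ a * ρ b) i j • (M.fW a μ ⊠ F j) := by
    simp only [Finset.smul_sum, smul_smul, Matrix.mul_apply, Finset.sum_smul]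
    exact Finset.sum_congr rfl fun a _ => Finset.sum_comm
  have h4 : ∑ j, ρ b i j • ∑ a, ∑ k, ρ a j k • (M.fW a μ ⊠ F k) =
      ∑ a, ∑ j, (ρ b * ρ a) i j • (M.fW a μ ⊠ F j) := by
    simp only [Finset.smul_sum, smul_smul, Matrix.mul_apply, Finset.sum_smul]
    rw [Finset.sum_comm]
    exact Finset.sum_congr rfl fun a _ => Finset.sum_comm
  -- The rotation of `W` in the adjoint representation supplies exactly the commutator needed to
  -- move `ρ b` to the left.
  have h5 : ∀ a j, ∑ c, (M.f a b c : ℂ) * ρ c i j + (ρ a * ρ b) i j = (ρ b * ρ a) i j := by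
    intro a j
    have := congrFun (congrFun (hρ a) i) j
    simp only [Matrix.sub_apply, Matrix.neg_apply, Matrix.sum_apply, Matrix.smul_apply,
      smul_eq_mul] at this
    linear_combination this
  simp only [map_sub, map_sum, map_smul, gaugeVar_pd, hF i, hsum, hW, smul_add,
    Finset.sum_add_distrib, smul_sub, Finset.sum_sub_distrib]
  rw [h1, h2, h3, h4]
  simp only [← h5, add_smul, Finset.sum_add_distrib]
  abel

/-- `W` itself is not a covariant multiplet, so `Covariant.covDeriv` does not apply. Terms linear in
`p` cancel between the derivatives and the shifts in the quadratic term (`h1`, `h2`), and the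
quadratic terms combine by the Jacobi identity (`h3`). -/
theorem covariant_fieldStrength (μ ρ : Fin 4) :
    M.Covariant b p (fun a d => (M.f a d b : ℂ)) (fun a => M.fieldStrength a μ ρ) := by
  intro a
  have hsum : ∀ (σ : Fin 4) (c : κ ⊕ ω → ℂ) (G : κ ⊕ ω → Func κ ω η ν),
      pd σ (∑ j, c j • G j) = ∑ j, c j • pd σ (G j) := fun σ c G => by
    simp only [← pdₗ_apply, map_sum, map_smul]
  have hone : ∀ (σ : Fin 4) (z : ℂ), pd σ (z • (opOne : Func κ ω η ν)) = 0 := by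
    intro σ z
    funext L; cases L <;> simp [pd, opOne, totalMom]
  have hadd : ∀ (σ : Fin 4) (F G : Func κ ω η ν), pd σ (F + G) = pd σ F + pd σ G :=
    fun σ => (pdₗ σ).map_add
  have hpd : ∀ σ τ : Fin 4, M.gaugeVar b p (pd σ (M.fW a τ)) =
      ∑ d, (M.f a d b : ℂ) • pd σ (M.fW d τ)
        - (I * (p σ : ℂ)) • (if a = b then -(I * (p τ : ℂ)) else 0) • opOne
        - (I * (p σ : ℂ)) • ∑ d, (M.f a d b : ℂ) • M.fW d τ := by
    intro σ τ
    rw [gaugeVar_pd, gaugeVar_fW, hadd, hone, hsum, smul_add]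
    abel
  have hW : ∀ e c, M.gaugeVar b p (M.fW e μ ⊠ M.fW c ρ) =
      (if e = b then -(I * (p μ : ℂ)) else 0) • M.fW c ρ
        + (if c = b then -(I * (p ρ : ℂ)) else 0) • M.fW e μ
        + (∑ d, (M.f e d b : ℂ) • (M.fW d μ ⊠ M.fW c ρ)
          + ∑ d, (M.f c d b : ℂ) • (M.fW e μ ⊠ M.fW d ρ)) := by
    intro e c
    rw [gaugeVar_opMul, gaugeVar_fW, gaugeVar_fW]
    simp only [add_opMul, opMul_add, smul_opMul, opOne_opMul, opMul_opOne, sum_opMul, opMul_sum,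
      opMul_smul]
    abel
  have h1 : ∑ e, ∑ c, (M.f a e c : ℂ) • (if e = b then -(I * (p μ : ℂ)) else 0) • M.fW c ρ =
      (I * (p μ : ℂ)) • ∑ d, (M.f a d b : ℂ) • M.fW d ρ := by
    rw [Finset.sum_eq_single b (by intro a _ h; simp [h]) (by simp), Finset.smul_sum]
    refine Finset.sum_congr rfl fun c _ => ?_
    rw [if_pos rfl, smul_smul, smul_smul, M.f_swap_right a c b]
    push_cast
    congr 1; ring
  have h2 : ∑ e, ∑ c, (M.f a e c : ℂ) • (if c = b then -(I * (p ρ : ℂ)) else 0) • M.fW e μ =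
      -((I * (p ρ : ℂ)) • ∑ d, (M.f a d b : ℂ) • M.fW d μ) := by
    rw [Finset.smul_sum, ← Finset.sum_neg_distrib]
    refine Finset.sum_congr rfl fun e _ => ?_
    rw [Finset.sum_eq_single b (by intro a _ h; simp [h]) (by simp), if_pos rfl, smul_smul,
      smul_smul, ← neg_smul]
    congr 1; ring
  have h3 : ∑ e, ∑ c, (M.f a e c : ℂ) • (∑ d, (M.f e d b : ℂ) • (M.fW d μ ⊠ M.fW c ρ)
        + ∑ d, (M.f c d b : ℂ) • (M.fW e μ ⊠ M.fW d ρ)) =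
      ∑ d, (M.f a d b : ℂ) • ∑ e, ∑ c, (M.f d e c : ℂ) • (M.fW e μ ⊠ M.fW c ρ) := by
    have hl : ∑ e, ∑ c, ∑ d, ((M.f a e c : ℂ) * M.f e d b) • (M.fW d μ ⊠ M.fW c ρ) =
        ∑ e, ∑ c, (∑ d, (M.f a d c : ℂ) * M.f d e b) • (M.fW e μ ⊠ M.fW c ρ) := by
      simp only [Finset.sum_smul]
      rw [Finset.sum_comm]
      conv_rhs => rw [Finset.sum_comm]
      exact Finset.sum_congr rfl fun c _ => Finset.sum_comm
    have hr : ∑ e, ∑ c, ∑ d, ((M.f a e c : ℂ) * M.f c d b) • (M.fW e μ ⊠ M.fW d ρ) =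
        ∑ e, ∑ c, (∑ d, (M.f a e d : ℂ) * M.f d c b) • (M.fW e μ ⊠ M.fW c ρ) := by
      simp only [Finset.sum_smul]
      exact Finset.sum_congr rfl fun e _ => Finset.sum_comm
    have ht : ∑ d, ∑ e, ∑ c, ((M.f a d b : ℂ) * M.f d e c) • (M.fW e μ ⊠ M.fW c ρ) =
        ∑ e, ∑ c, (∑ d, (M.f a d b : ℂ) * M.f d e c) • (M.fW e μ ⊠ M.fW c ρ) := by
      simp only [Finset.sum_smul]
      rw [Finset.sum_comm]
      exact Finset.sum_congr rfl fun e _ => Finset.sum_comm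
    simp only [smul_add, Finset.smul_sum, smul_smul, Finset.sum_add_distrib]
    rw [hl, hr, ht]
    simp only [← Finset.sum_add_distrib, ← add_smul]
    refine Finset.sum_congr rfl fun e _ => Finset.sum_congr rfl fun c _ => ?_
    congr 1
    -- Comparing coefficients of `W_e W_c`: the adjoint matrices represent the algebra, which is the
    -- Jacobi identity up to permuting indices of `f`.
    have hJ := M.jacobi a b e c
    rw [← sub_eq_zero, ← Finset.sum_sub_distrib]
    have : ∀ d, (M.f a d c : ℂ) * M.f d e b + M.f a e d * M.f d c b - M.f a d b * M.f d e c =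
        ((M.f a b d * M.f e c d + M.f e a d * M.f b c d + M.f a c d * M.f b e d : ℝ) : ℂ) := by
      intro d
      rw [M.f_swap_right a c d, M.f_cycl e b d, M.f_cycl c b d, M.f_swap_right a b d,
        M.f_cycl e c d, M.f_swap_left a e d, M.f_swap_left c b d, M.f_swap_left e b d]
      push_cast; ring
    simp only [this, ← Complex.ofReal_sum, hJ, Complex.ofReal_zero]
  simp only [fieldStrength, map_add, map_sub, map_sum, map_smul, hpd, hW]
  simp only [smul_add, Finset.sum_add_distrib] at h3
  simp only [smul_add, smul_sub, Finset.sum_add_distrib, Finset.sum_sub_distrib]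
  rw [h1, h2, h3]
  -- The field-independent terms `p_μ p_ρ` are symmetric, so they cancel in the antisymmetrized
  -- derivative.
  have hc : (I * (p μ : ℂ)) • (if a = b then -(I * (p ρ : ℂ)) else 0) • (opOne : Func κ ω η ν) =
      (I * (p ρ : ℂ)) • (if a = b then -(I * (p μ : ℂ)) else 0) • opOne := by
    rw [smul_smul, smul_smul]
    congr 1
    split_ifs <;> ring
  rw [hc]
  abel

end BrokenGaugeTheory

/-! ### Invariant coefficients of the scalar potential -/

section Potential

open MvPolynomial

variable {S : Type*} [Fintype S] [DecidableEq S]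

theorem pderiv_sum_linear (c : S → ℝ) (Z : S) :
    pderiv Z (∑ B, C (c B) * X B) = C (c Z) := by
  simp [Derivation.leibniz, pderiv_X, Pi.single_apply]

theorem pderiv_sum_quadratic (c : S → S → ℝ) (Z : S) :
    pderiv Z (∑ B, ∑ D, C (c B D) * (X B * X D)) =
      ∑ D, C (c Z D) * X D + ∑ D, C (c D Z) * X D := by
  have h : ∀ B D, pderiv Z (C (c B D) * (X B * X D)) =
      (if B = Z then C (c B D) * X D else 0) + (if D = Z then C (c B D) * X B else 0) := by
    intro B D
    simp only [Derivation.leibniz, pderiv_C, pderiv_X, Pi.single_apply, smul_eq_mul]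
    split_ifs <;> ring
  simp only [map_sum, h, Finset.sum_add_distrib]
  congr 1
  · rw [Finset.sum_eq_single Z (by intro B _ hB; simp [hB]) (by simp)]
    simp
  · simp

theorem pderiv_sum_cubic (c : S → S → S → ℝ) (Z : S) :
    pderiv Z (∑ B, ∑ D, ∑ E, C (c B D E) * (X B * X D * X E)) =
      ∑ D, ∑ E, C (c Z D E) * (X D * X E) + ∑ D, ∑ E, C (c D Z E) * (X D * X E)
        + ∑ D, ∑ E, C (c D E Z) * (X D * X E) := by
  have h : ∀ B D E, pderiv Z (C (c B D E) * (X B * X D * X E)) =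
      (if B = Z then C (c B D E) * (X D * X E) else 0)
        + (if D = Z then C (c B D E) * (X B * X E) else 0)
        + (if E = Z then C (c B D E) * (X B * X D) else 0) := by
    intro B D E
    simp only [Derivation.leibniz, pderiv_C, pderiv_X, Pi.single_apply, smul_eq_mul]
    split_ifs <;> ring
  simp only [map_sum, h, Finset.sum_add_distrib]
  congr 1
  · congr 1
    · rw [Finset.sum_eq_single Z (by intro B _ hB; simp [hB]) (by simp)]
      simp
    · refine Finset.sum_congr rfl fun B _ => ?_
      rw [Finset.sum_eq_single Z (by intro B _ hB; simp [hB]) (by simp)]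
      simp
  · simp

/-- Gauge invariance of a quartic potential, as invariance of its coefficients. -/
theorem potential_coeff_invariant {g2 : S → S → ℝ} {g3 : S → S → S → ℝ}
    {g4 : S → S → S → S → ℝ} (h3 : ∀ A B C, g3 B A C = g3 A B C ∧ g3 A C B = g3 A B C)
    (h4 : ∀ A B C D, g4 B A C D = g4 A B C D ∧ g4 A C B D = g4 A B C D ∧
      g4 A B D C = g4 A B C D)
    {T : Matrix S S ℝ}
    (hT : ∀ φ : S → ℝ, ∑ A, ∑ B, gradPotential g2 g3 g4 φ A * T A B * φ B = 0) :
    (∀ B C, ∑ A, (g2 A C * T A B + g2 A B * T A C) = 0) ∧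
    (∀ B C D, ∑ A, (g3 A C D * T A B + g3 A B D * T A C + g3 A B C * T A D) = 0) ∧
    (∀ B C D E, ∑ A, (g4 A C D E * T A B + g4 A B D E * T A C + g4 A B C E * T A D
      + g4 A B C D * T A E) = 0) := by
  -- `G`, `H`, `K` are the gradient, Hessian and third derivatives of the potential as polynomials;
  -- `U` below is the vector field generated by `T`.
  let G : S → MvPolynomial S ℝ := fun A =>
    ∑ B, C (g2 A B) * X B + C (1 / 2) * ∑ B, ∑ D, C (g3 A B D) * (X B * X D)
      + C (1 / 6) * ∑ B, ∑ D, ∑ E, C (g4 A B D E) * (X B * X D * X E)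
  let H : S → S → MvPolynomial S ℝ := fun A B =>
    C (g2 A B) + ∑ D, C (g3 A B D) * X D + C (1 / 2) * ∑ D, ∑ E, C (g4 A B D E) * (X D * X E)
  let K : S → S → S → MvPolynomial S ℝ := fun A B D =>
    C (g3 A B D) + ∑ E, C (g4 A B D E) * X E
  have h12 : (C (1 / 2) : MvPolynomial S ℝ) * 2 = 1 := by
    rw [← map_ofNat C 2, ← C_mul]; norm_num
  have h16 : (C (1 / 6) : MvPolynomial S ℝ) * 3 = C (1 / 2) := by
    rw [← map_ofNat C 3, ← C_mul]; norm_num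
  have e3 : ∀ A B Z, g3 A B Z = g3 A Z B := fun A B Z => (h3 A Z B).2
  have e4 : ∀ A B Z D, g4 A B Z D = g4 A Z B D := fun A B Z D => (h4 A Z B D).2.1
  have e4' : ∀ A B D Z, g4 A B D Z = g4 A Z B D := fun A B D Z => by
    rw [(h4 A B Z D).2.2, e4]
  have hG : ∀ A Z, pderiv Z (G A) = H A Z := by
    intro A Z
    simp only [G, H]
    rw [map_add, map_add, pderiv_C_mul, pderiv_C_mul, pderiv_sum_linear, pderiv_sum_quadratic,
      pderiv_sum_cubic]
    simp only [fun B => e3 A B Z, fun B D => e4 A B Z D, fun B D => e4' A B D Z]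
    linear_combination (∑ D, C (g3 A Z D) * X D) * h12
      + (∑ D, ∑ E, C (g4 A Z D E) * (X D * X E)) * h16
  have hH : ∀ A B Z, pderiv Z (H A B) = K A B Z := by
    intro A B Z
    simp only [H, K]
    rw [map_add, map_add, pderiv_C, pderiv_C_mul, pderiv_sum_linear, pderiv_sum_quadratic]
    simp only [fun D => (h4 A B Z D).2.2]
    linear_combination (∑ D, C (g4 A B Z D) * X D) * h12
  have hK : ∀ A B D Z, pderiv Z (K A B D) = C (g4 A B D Z) := by
    intro A B D Z
    simp only [K]
    rw [map_add, pderiv_C, pderiv_sum_linear, zero_add]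
  let U : S → MvPolynomial S ℝ := fun A => ∑ B, C (T A B) * X B
  have hU : ∀ A Z, pderiv Z (U A) = C (T A Z) := fun A Z => pderiv_sum_linear (T A) Z
  -- Equality at all real points is equality of polynomials, since `ℝ` is infinite. The identity may
  -- then be differentiated formally.
  have h0 : ∑ A, G A * U A = 0 := by
    refine MvPolynomial.funext fun φ => ?_
    rw [map_zero, ← hT φ, map_sum]
    refine Finset.sum_congr rfl fun A _ => ?_
    simp only [G, U, gradPotential, map_mul, map_add, map_sum, eval_C, eval_X, Finset.mul_sum,
      mul_assoc]
  have h1 : ∀ B, ∑ A, (H A B * U A + G A * C (T A B)) = 0 := by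
    intro B
    have := congrArg (pderiv B) h0
    simp only [map_sum, Derivation.leibniz, hG, hU, map_zero, smul_eq_mul] at this
    rw [← this]
    exact Finset.sum_congr rfl fun _ _ => by ring
  have h2 : ∀ B D, ∑ A, (K A B D * U A + H A B * C (T A D) + H A D * C (T A B)) = 0 := by
    intro B D
    have := congrArg (pderiv D) (h1 B)
    simp only [map_sum, map_add, Derivation.leibniz, hG, hH, hU, map_zero, smul_eq_mul,
      pderiv_C] at this
    rw [← this]
    exact Finset.sum_congr rfl fun _ _ => by ring
  have h3 : ∀ B D E, ∑ A, (C (g4 A B D E) * U A + K A B D * C (T A E) + K A B E * C (T A D)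
      + K A D E * C (T A B)) = 0 := by
    intro B D E
    have := congrArg (pderiv E) (h2 B D)
    simp only [map_sum, map_add, Derivation.leibniz, hH, hK, hU, map_zero, smul_eq_mul,
      pderiv_C] at this
    rw [← this]
    exact Finset.sum_congr rfl fun _ _ => by ring
  have h4 : ∀ B D E F, ∑ A, (C (g4 A B D E * T A F) + C (g4 A B D F * T A E)
      + C (g4 A B E F * T A D) + C (g4 A D E F * T A B) : MvPolynomial S ℝ) = 0 := by
    intro B D E F
    have := congrArg (pderiv F) (h3 B D E)
    simp only [map_sum, map_add, Derivation.leibniz, hK, hU, map_zero, smul_eq_mul,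
      pderiv_C] at this
    rw [← this]
    exact Finset.sum_congr rfl fun _ _ => by simp only [C_mul]; ring
  -- At the origin `U` vanishes and each derivative of the potential reduces to its constant
  -- coefficient. The identities from two, three and four differentiations give invariance of `g2`,
  -- `g3` and `g4`.
  refine ⟨fun B D => ?_, fun B D E => ?_, fun B D E F => ?_⟩
  · have := congrArg (eval (0 : S → ℝ)) (h2 B D)
    simp only [map_sum, map_add, map_mul, K, H, U, eval_C, eval_X, Pi.zero_apply, mul_zero,
      Finset.sum_const_zero, add_zero, zero_add, map_zero] at this
    rw [← this]
    exact Finset.sum_congr rfl fun _ _ => by ring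
  · have := congrArg (eval (0 : S → ℝ)) (h3 B D E)
    simp only [map_sum, map_add, map_mul, K, U, eval_C, eval_X, Pi.zero_apply, mul_zero,
      Finset.sum_const_zero, add_zero, zero_add, map_zero] at this
    rw [← this]
    exact Finset.sum_congr rfl fun _ _ => by ring
  · have := congrArg (eval (0 : S → ℝ)) (h4 B D E F)
    simp only [map_sum, map_add, eval_C, map_zero] at this
    rw [← this]
    exact Finset.sum_congr rfl fun _ _ => by ring

end Potential

/-! ### Chiral projectors -/

section Dirac

theorem diracGamma5_eq : diracGamma5 = Matrix.diagonal ![-1, -1, 1, 1] := by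
  ext i j
  fin_cases i <;> fin_cases j <;>
    simp [diracGamma5, diracGamma]

theorem projL_eq : projL = Matrix.diagonal ![1, 1, 0, 0] := by
  ext i j
  fin_cases i <;> fin_cases j <;> simp [projL, diracGamma5_eq] <;> norm_num

theorem projR_eq : projR = Matrix.diagonal ![0, 0, 1, 1] := by
  ext i j
  fin_cases i <;> fin_cases j <;> simp [projR, diracGamma5_eq] <;> norm_num

theorem projL_mul_projL : projL * projL = projL := by
  rw [projL_eq, Matrix.diagonal_mul_diagonal]
  congr 1; ext i; fin_cases i <;> simp

theorem projR_mul_projR : projR * projR = projR := by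
  rw [projR_eq, Matrix.diagonal_mul_diagonal]
  congr 1; ext i; fin_cases i <;> simp

theorem projL_mul_projR : projL * projR = 0 := by
  rw [projL_eq, projR_eq, Matrix.diagonal_mul_diagonal, ← Matrix.diagonal_zero]
  congr 1; ext i; fin_cases i <;> simp

theorem projR_mul_projL : projR * projL = 0 := by
  rw [projL_eq, projR_eq, Matrix.diagonal_mul_diagonal, ← Matrix.diagonal_zero]
  congr 1; ext i; fin_cases i <;> simp

theorem diracGamma_mul_projL (μ : Fin 4) : diracGamma μ * projL = projR * diracGamma μ := by
  rw [projL_eq, projR_eq]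
  ext i j
  rw [Matrix.mul_diagonal, Matrix.diagonal_mul]
  fin_cases μ <;> fin_cases i <;> fin_cases j <;> simp [diracGamma]

theorem diracGamma_mul_projR (μ : Fin 4) : diracGamma μ * projR = projL * diracGamma μ := by
  rw [projL_eq, projR_eq]
  ext i j
  rw [Matrix.mul_diagonal, Matrix.diagonal_mul]
  fin_cases μ <;> fin_cases i <;> fin_cases j <;> simp [diracGamma]

end Dirac

/-! ### Gauge invariance of the classical Lagrangian -/

namespace BrokenGaugeTheory

variable {κ ω η ν : Type*} [Fintype κ] [Fintype ω] [Fintype η] [Fintype ν]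
  [DecidableEq κ] [DecidableEq ω] [DecidableEq η] [DecidableEq ν]

variable (M : BrokenGaugeTheory κ ω η ν) (b : κ ⊕ ω) (p : Momentum)

theorem gaugeVar_lagYM : M.gaugeVar b p M.lagYM = 0 := by
  have h : ∀ μ ρ, M.gaugeVar b p (∑ a, M.fieldStrength a μ ρ ⊠ M.fieldStrength a μ ρ) = 0 :=
    fun μ ρ => (M.covariant_fieldStrength b p μ ρ).gaugeVar_sum_opMul_self fun a d => by
      rw [M.f_swap_left a d b]; push_cast; ring
  have e : M.lagYM = (-1 / 4 : ℂ) • ∑ μ, ∑ ρ, ((eta μ * eta ρ : ℝ) : ℂ) •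
      ∑ a, M.fieldStrength a μ ρ ⊠ M.fieldStrength a μ ρ := by
    rw [lagYM, Finset.sum_comm]
    congr 1
    refine Finset.sum_congr rfl fun μ _ => ?_
    rw [Finset.sum_comm]
    simp only [Finset.smul_sum]
  rw [e]
  simp only [map_smul, map_sum (M.gaugeVar b p) _ (Finset.univ : Finset (Fin 4)), h, smul_zero,
    Finset.sum_const_zero]

theorem scalMat_comm (a : κ ⊕ ω) :
    M.scalMat a * M.scalMat b - M.scalMat b * M.scalMat a =
      -∑ c, (M.f a b c : ℂ) • M.scalMat c := by
  ext A B
  have := congrFun (congrFun (M.T_comm a b) A) B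
  simp only [Matrix.sub_apply, Matrix.mul_apply, Matrix.sum_apply, Matrix.smul_apply,
    smul_eq_mul] at this
  simp only [Matrix.sub_apply, Matrix.mul_apply, Matrix.sum_apply, Matrix.smul_apply,
    smul_eq_mul, Matrix.neg_apply, scalMat, Matrix.of_apply, neg_mul, mul_neg, neg_neg,
    Finset.sum_neg_distrib]
  exact_mod_cast this

theorem covariant_covPhi (μ : Fin 4) :
    M.Covariant b p (M.scalMat b) (fun A => M.covPhi A μ) := by
  have h := (M.covariant_fPhi b p).covDeriv M b p M.scalMat (M.scalMat_comm b) μ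
  simpa only [covPhi, scalMat, Matrix.of_apply, neg_smul, Finset.sum_neg_distrib,
    sub_neg_eq_add] using h

/-- The coefficients are invariant tensors by `potential_coeff_invariant`. Their symmetry brings the
contracted index to the first place, and the overall sign comes from `scalMat` being `-T`. -/
theorem gaugeVar_lagPotential : M.gaugeVar b p M.lagPotential = 0 := by
  obtain ⟨h2, h3, h4⟩ := potential_coeff_invariant M.g3_symm M.g4_symm (M.potential_inv b)
  have hP := M.covariant_fPhi b p
  have e2 : M.gaugeVar b p (∑ A, ∑ B, (M.g2 A B : ℂ) • (M.fPhi A ⊠ M.fPhi B)) = 0 := by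
    refine hP.gaugeVar_sum_bilin hP fun B C => ?_
    rw [← Finset.sum_add_distrib, ← neg_eq_zero, ← Complex.ofReal_zero, ← h2 B C,
      Complex.ofReal_sum, ← Finset.sum_neg_distrib]
    refine Finset.sum_congr rfl fun A _ => ?_
    rw [M.g2_symm A B, scalMat, Matrix.of_apply, Matrix.of_apply]
    push_cast; ring
  have e3 : M.gaugeVar b p (∑ A, ∑ B, ∑ C, (M.g3 A B C : ℂ) •
      (M.fPhi A ⊠ M.fPhi B ⊠ M.fPhi C)) = 0 := by
    refine hP.gaugeVar_sum_trilin hP hP fun B C D => ?_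
    rw [← Finset.sum_add_distrib, ← Finset.sum_add_distrib, ← neg_eq_zero, ← Complex.ofReal_zero,
      ← h3 B C D, Complex.ofReal_sum, ← Finset.sum_neg_distrib]
    refine Finset.sum_congr rfl fun A _ => ?_
    rw [(M.g3_symm B C A).2.symm, (M.g3_symm A B C).1, (M.g3_symm A B D).1, scalMat,
      Matrix.of_apply, Matrix.of_apply, Matrix.of_apply]
    push_cast; ring
  have e4 : M.gaugeVar b p (∑ A, ∑ B, ∑ C, ∑ D, (M.g4 A B C D : ℂ) •
      (M.fPhi A ⊠ M.fPhi B ⊠ M.fPhi C ⊠ M.fPhi D)) = 0 := by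
    refine hP.gaugeVar_sum_quadrilin hP hP hP fun B C D E => ?_
    rw [← Finset.sum_add_distrib, ← Finset.sum_add_distrib, ← Finset.sum_add_distrib,
      ← neg_eq_zero, ← Complex.ofReal_zero,
      ← h4 B C D E, Complex.ofReal_sum, ← Finset.sum_neg_distrib]
    refine Finset.sum_congr rfl fun A _ => ?_
    have s1 : M.g4 B A D E = M.g4 A B D E := (M.g4_symm A B D E).1
    have s2 : M.g4 B C A E = M.g4 A B C E := by
      rw [(M.g4_symm B A C E).2.1, (M.g4_symm A B C E).1]
    have s3 : M.g4 B C D A = M.g4 A B C D := by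
      rw [(M.g4_symm B C A D).2.2, (M.g4_symm B A C D).2.1, (M.g4_symm A B C D).1]
    rw [s1, s2, s3, scalMat, Matrix.of_apply, Matrix.of_apply, Matrix.of_apply, Matrix.of_apply]
    push_cast; ring
  rw [lagPotential, map_add, map_add, map_smul, map_smul, map_smul, e2, e3, e4]
  simp only [smul_zero, add_zero]

theorem gaugeVar_lagScalar : M.gaugeVar b p M.lagScalar = 0 := by
  have h : ∀ μ, M.gaugeVar b p (∑ A, M.covPhi A μ ⊠ M.covPhi A μ) = 0 :=
    fun μ => (M.covariant_covPhi b p μ).gaugeVar_sum_opMul_self fun A B => by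
      rw [scalMat, Matrix.of_apply, Matrix.of_apply, M.T_antisymm b A B]; push_cast; ring
  rw [lagScalar, map_sub, gaugeVar_lagPotential, sub_zero, Finset.sum_comm]
  simp only [← Finset.smul_sum]
  simp only [map_smul, map_sum (M.gaugeVar b p) _ (Finset.univ : Finset (Fin 4)), h, smul_zero,
    Finset.sum_const_zero]

/-- `P_L` and `P_R` are orthogonal idempotents, so the two chiralities represent the algebra
independently. -/
theorem tauMat_comm (a : κ ⊕ ω) :
    M.tauMat a * M.tauMat b - M.tauMat b * M.tauMat a =
      ∑ c, (I * (M.f a b c : ℂ)) • M.tauMat c := by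
  have h : ∀ c d : κ ⊕ ω, M.tauMat c * M.tauMat d =
      Matrix.kronecker (M.τL c * M.τL d) projL + Matrix.kronecker (M.τR c * M.τR d) projR := by
    intro c d
    simp only [tauMat, Matrix.kronecker, mul_add, add_mul, ← Matrix.mul_kronecker_mul,
      projL_mul_projL, projR_mul_projR, projL_mul_projR, projR_mul_projL, Matrix.kronecker_zero,
      add_zero, zero_add]
  have hL := M.τL_comm a b
  have hR := M.τR_comm a b
  ext ⟨i, s⟩ ⟨j, t⟩
  have hL' := congrFun (congrFun hL i) j
  have hR' := congrFun (congrFun hR i) j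
  simp only [Matrix.sub_apply, Matrix.sum_apply, Matrix.smul_apply, smul_eq_mul] at hL' hR'
  rw [h, h]
  simp only [Matrix.sub_apply, Matrix.add_apply, Matrix.sum_apply, Matrix.smul_apply, smul_eq_mul,
    tauMat, Matrix.kronecker, Matrix.kroneckerMap_apply, mul_add,
    Finset.sum_add_distrib, ← mul_assoc, ← Finset.sum_mul, ← hL', ← hR']
  ring

/-- The general covariant derivative is used with `ρ a = i τ^a`, whose commutators have the same
structure constants and sign as those of `-T^a`. -/
theorem covariant_covPsi (μ : Fin 4) :
    M.Covariant b p (I • M.tauMat b) (fun x : ν × Fin 4 => M.covPsi x.1 x.2 μ) := by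
  have h := (M.covariant_fpsi b p).covDeriv M b p (fun a => I • M.tauMat a) (by
    intro a
    have := M.tauMat_comm b a
    simp only [smul_mul_smul_comm, Complex.I_mul_I, ← smul_sub, this, smul_smul, mul_comm I]
    simp only [← smul_smul, Finset.smul_sum]
    simp) μ
  have e : ∀ x : ν × Fin 4, pd μ (M.fpsi x.1 x.2) - ∑ a, ∑ y : ν × Fin 4, (I • M.tauMat a) x y •
      (M.fW a μ ⊠ M.fpsi y.1 y.2) = M.covPsi x.1 x.2 μ := by
    intro x
    simp only [covPsi, Fintype.sum_prod_type, Finset.smul_sum, smul_smul]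
    rfl
  simpa only [e] using h

/-- The matrix `X^A P_L + X^{A†} P_R`. -/
noncomputable def yukawaMat (A : κ ⊕ η) : Matrix (ν × Fin 4) (ν × Fin 4) ℂ :=
  Matrix.kronecker (M.X A) projL + Matrix.kronecker (M.X A).conjTranspose projR

/-- The `P_L` part is the Yukawa condition `X_inv`. The `P_R` part is its hermitian conjugate, using
hermitian `τ` and real `T`. -/
theorem yukawaMat_invariant (A : κ ⊕ η) :
    -(I • (M.tauMatBar b * M.yukawaMat A)) + I • (M.yukawaMat A * M.tauMat b)
      + ∑ B, M.scalMat b B A • M.yukawaMat B = 0 := by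
  have h := M.X_inv b A
  have h' := congrArg Matrix.conjTranspose h
  simp only [Matrix.conjTranspose_add, Matrix.conjTranspose_neg, Matrix.conjTranspose_smul,
    Matrix.conjTranspose_mul, (M.τL_herm b).eq, (M.τR_herm b).eq, Matrix.conjTranspose_sum,
    Complex.star_def, Complex.conj_I, Complex.conj_ofReal] at h'
  simp only [tauMat, tauMatBar, yukawaMat, Matrix.kronecker, mul_add, add_mul,
    ← Matrix.mul_kronecker_mul, projL_mul_projL, projR_mul_projR, projL_mul_projR,
    projR_mul_projL, Matrix.kronecker_zero, add_zero, zero_add]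
  ext ⟨i, s⟩ ⟨j, t⟩
  have hL := congrFun (congrFun h i) j
  have hR := congrFun (congrFun h' i) j
  simp only [Matrix.add_apply, Matrix.neg_apply, Matrix.sum_apply, Matrix.smul_apply,
    smul_eq_mul] at hL hR
  simp only [Matrix.add_apply, Matrix.neg_apply, Matrix.sum_apply, Matrix.smul_apply, smul_eq_mul,
    Matrix.kroneckerMap_apply, Matrix.zero_apply, scalMat, Matrix.of_apply, mul_add,
    Finset.sum_add_distrib, neg_mul, Finset.sum_neg_distrib, ← mul_assoc, ← Finset.sum_mul,
    ← hL, ← hR]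
  ring

theorem gaugeVar_lagFermion : M.gaugeVar b p M.lagFermion = 0 := by
  have hk : ∀ μ, M.gaugeVar b p (∑ i, ∑ s, ∑ t, diracGamma μ s t •
      (M.fpsibar i s ⊠ M.covPsi i t μ)) = 0 := by
    intro μ
    have := (M.covariant_fpsibar b p).gaugeVar_sum_bilin (M.covariant_covPsi b p μ)
      (C := Matrix.kronecker 1 (diracGamma μ)) (by
      intro x y
      -- Dirac matrices exchange chiralities, so moving `γ^μ` past the generator turns the matrix
      -- acting on `ψ̄` into the one acting on `ψ`. The kinetic tensor is therefore invariant.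
      have h : M.tauMatBar b * Matrix.kronecker 1 (diracGamma μ) =
          Matrix.kronecker 1 (diracGamma μ) * M.tauMat b := by
        simp only [tauMat, tauMatBar, Matrix.kronecker, mul_add, add_mul,
          ← Matrix.mul_kronecker_mul, mul_one, one_mul, diracGamma_mul_projL,
          diracGamma_mul_projR]
      have h' := congrFun (congrFun h x) y
      simp only [Matrix.mul_apply] at h'
      simp only [Matrix.neg_apply, Matrix.smul_apply, Matrix.transpose_apply, smul_eq_mul]
      rw [← mul_zero (-I), ← sub_eq_zero.2 h', mul_sub, Finset.mul_sum, Finset.mul_sum,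
        sub_eq_add_neg, ← Finset.sum_neg_distrib]
      congr 1
      · exact Finset.sum_congr rfl fun _ _ => by ring
      · exact Finset.sum_congr rfl fun _ _ => by ring)
    rw [← this]
    congr 1
    simp only [Fintype.sum_prod_type, Matrix.kronecker, Matrix.kroneckerMap_apply]
    refine Finset.sum_congr rfl fun i _ => Finset.sum_congr rfl fun s _ => ?_
    rw [Finset.sum_eq_single i (by intro j _ h; simp [Ne.symm h]) (by simp)]
    simp
  have hy : M.gaugeVar b p (∑ A, ∑ i, ∑ j, ∑ s, ∑ t,
      (M.X A i j * projL s t + (M.X A).conjTranspose i j * projR s t) •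
        (M.fpsibar i s ⊠ M.fPhi A ⊠ M.fpsi j t)) = 0 := by
    have := (M.covariant_fpsibar b p).gaugeVar_sum_trilin (M.covariant_fPhi b p)
      (M.covariant_fpsi b p) (C := fun x A y => M.yukawaMat A x y) (by
      intro x A y
      have h := congrFun (congrFun (M.yukawaMat_invariant b A) x) y
      simp only [Matrix.add_apply, Matrix.neg_apply, Matrix.smul_apply, smul_eq_mul,
        Matrix.mul_apply, Matrix.sum_apply, Matrix.zero_apply] at h
      simp only [Matrix.neg_apply, Matrix.smul_apply, Matrix.transpose_apply, smul_eq_mul]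
      rw [← h, add_right_comm, Finset.mul_sum, Finset.mul_sum, ← Finset.sum_neg_distrib]
      congr 1
      · congr 1 <;> exact Finset.sum_congr rfl fun _ _ => by ring
      · exact Finset.sum_congr rfl fun _ _ => by ring)
    rw [← this]
    congr 1
    simp only [Fintype.sum_prod_type]
    rw [Finset.sum_comm]
    refine Finset.sum_congr rfl fun i _ => ?_
    have : ∀ A : κ ⊕ η, (∑ j, ∑ s, ∑ t, (M.X A i j * projL s t
        + (M.X A).conjTranspose i j * projR s t) • (M.fpsibar i s ⊠ M.fPhi A ⊠ M.fpsi j t)) =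
        ∑ s, ∑ j, ∑ t, M.yukawaMat A (i, s) (j, t) •
          (M.fpsibar i s ⊠ M.fPhi A ⊠ M.fpsi j t) := fun A => Finset.sum_comm
    simp only [this]
    exact Finset.sum_comm
  rw [lagFermion, map_add, hy, add_zero, map_smul, Finset.sum_comm, map_sum]
  simp only [hk, Finset.sum_const_zero, smul_zero]

end BrokenGaugeTheory

/-! ### Polynomials in the fields alone -/

section FieldPolynomials

variable {κ ω η ν : Type*} [DecidableEq κ] [DecidableEq ω] [DecidableEq η] [DecidableEq ν]

/-- Polynomials in the fields (without ghosts and sources) and their derivatives. -/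
inductive FieldPoly : Func κ ω η ν → Prop
  | one : FieldPoly opOne
  | basic (Φ : Fld κ ω η ν) : FieldPoly (basic (.fld Φ))
  | zero : FieldPoly 0
  | add {F G : Func κ ω η ν} : FieldPoly F → FieldPoly G → FieldPoly (F + G)
  | smul {F : Func κ ω η ν} (z : ℂ) : FieldPoly F → FieldPoly (z • F)
  | opMul {F G : Func κ ω η ν} : FieldPoly F → FieldPoly G → FieldPoly (F ⊠ G)
  | pd {F : Func κ ω η ν} (μ : Fin 4) : FieldPoly F → FieldPoly (pd μ F)

namespace FieldPoly

theorem sub {F G : Func κ ω η ν} (hF : FieldPoly F) (hG : FieldPoly G) : FieldPoly (F - G) := by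
  have := hF.add (hG.smul (-1))
  rwa [neg_one_smul, ← sub_eq_add_neg] at this

theorem sum {ι : Type*} {s : Finset ι} {F : ι → Func κ ω η ν} (hF : ∀ i, FieldPoly (F i)) :
    FieldPoly (∑ i ∈ s, F i) := by
  classical
  induction s using Finset.induction_on with
  | empty => exact zero
  | insert i s hi ih =>
    rw [Finset.sum_insert hi]
    exact (hF i).add ih

/-- A `Func` is an arbitrary function of ordered lists, with no symmetry built in. Polynomials in
the fields acquire the exchange symmetry of commuting legs from their construction. -/
theorem evenSymm {F : Func κ ω η ν} (hF : FieldPoly F) : EvenSymm F := by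
  induction hF with
  | one => exact EvenSymm.opOne
  | basic Φ => exact EvenSymm.basic _
  | zero => exact fun _ _ _ _ => rfl
  | add _ _ hF hG => exact hF.add hG
  | smul z _ hF => exact hF.smul z
  | opMul _ _ hF hG => exact hF.opMul hG
  | pd μ _ hF => exact hF.pd μ

theorem eq_zero_of_mem {F : Func κ ω η ν} (hF : FieldPoly F) (L : List (Leg κ ω η ν))
    (hL : ∃ ℓ ∈ L, ∀ Φ, ℓ.field ≠ .fld Φ) : F L = 0 := by
  induction hF generalizing L with
  | one =>
    cases L with
    | nil => simp at hL
    | cons _ _ => rfl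
  | basic Φ =>
    rcases L with _ | ⟨ℓ, _ | ⟨k, L⟩⟩
    · rfl
    · obtain ⟨k, hk, h⟩ := hL
      obtain rfl : k = ℓ := by simpa using hk
      simp [SBGT.basic, h Φ]
    · rfl
  | zero => rfl
  | add _ _ hF hG => rw [Pi.add_apply, hF L hL, hG L hL, add_zero]
  | smul z _ hF => rw [Pi.smul_apply, hF L hL, smul_zero]
  | opMul _ _ hF hG => exact mulCoeff_eq_zero_of_mem _ _ hF hG L hL
  | pd μ _ hF => rw [SBGT.pd, hF L hL, mul_zero]

end FieldPoly

end FieldPolynomials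

/-! ### The Ward identity with two contractions, and the gauge fixing terms -/

namespace BrokenGaugeTheory

variable {κ ω η ν : Type*} [Fintype κ] [Fintype ω] [Fintype η] [Fintype ν]
  [DecidableEq κ] [DecidableEq ω] [DecidableEq η] [DecidableEq ν]

variable (M : BrokenGaugeTheory κ ω η ν)

/-- The gauge invariant part of the tree-level action. -/
noncomputable def invAction : Func κ ω η ν := M.lagYM + M.lagScalar + M.lagFermion

/-- The gauge fixing part of the tree-level action. -/
noncomputable def gfAction (ξ : ℝ) : Func κ ω η ν :=
  -((1 / (2 * ξ) : ℂ) • ∑ a, (M.gaugeFix ξ a ⊠ M.gaugeFix ξ a))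

theorem fieldPoly_fW (a : κ ⊕ ω) (μ : Fin 4) : FieldPoly (M.fW a μ) := .basic _

theorem fieldPoly_fPhi (A : κ ⊕ η) : FieldPoly (M.fPhi A) :=
  (FieldPoly.one.smul _).add (.basic _)

theorem fieldPoly_fieldStrength (a : κ ⊕ ω) (μ ρ : Fin 4) :
    FieldPoly (M.fieldStrength a μ ρ) :=
  (((M.fieldPoly_fW a ρ).pd μ).sub ((M.fieldPoly_fW a μ).pd ρ)).add
    (.sum fun b => .sum fun c => ((M.fieldPoly_fW b μ).opMul (M.fieldPoly_fW c ρ)).smul _)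

theorem fieldPoly_covPhi (A : κ ⊕ η) (μ : Fin 4) : FieldPoly (M.covPhi A μ) :=
  ((M.fieldPoly_fPhi A).pd μ).add
    (.sum fun a => .sum fun B => ((M.fieldPoly_fW a μ).opMul (M.fieldPoly_fPhi B)).smul _)

theorem fieldPoly_covPsi (i : ν) (s μ : Fin 4) : FieldPoly (M.covPsi i s μ) :=
  (FieldPoly.pd μ (.basic _)).sub (.smul _ (.sum fun a =>
    .sum fun _ => .sum fun _ => .smul _ ((M.fieldPoly_fW a μ).opMul (.basic _))))

theorem fieldPoly_lagPotential : FieldPoly M.lagPotential :=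
  have h := M.fieldPoly_fPhi
  ((FieldPoly.smul _ (.sum fun A => .sum fun B => ((h A).opMul (h B)).smul _)).add
    (.smul _ (.sum fun A => .sum fun B => .sum fun C =>
      (((h A).opMul (h B)).opMul (h C)).smul _))).add
    (.smul _ (.sum fun A => .sum fun B => .sum fun C => .sum fun D =>
      ((((h A).opMul (h B)).opMul (h C)).opMul (h D)).smul _))

theorem fieldPoly_invAction : FieldPoly M.invAction := by
  refine FieldPoly.add (FieldPoly.add ?_ (FieldPoly.sub ?_ M.fieldPoly_lagPotential))
    (FieldPoly.add ?_ ?_)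
  · exact .smul _ (.sum fun a => .sum fun μ => .sum fun ρ => .smul _
      ((M.fieldPoly_fieldStrength a μ ρ).opMul (M.fieldPoly_fieldStrength a μ ρ)))
  · exact .smul _ (.sum fun A => .sum fun μ => .smul _
      ((M.fieldPoly_covPhi A μ).opMul (M.fieldPoly_covPhi A μ)))
  · exact .smul _ (.sum fun i => .sum fun μ => .sum fun s => .sum fun t => .smul _
      (.opMul (.basic _) (M.fieldPoly_covPsi i t μ)))
  · exact .sum fun A => .sum fun i => .sum fun j => .sum fun s => .sum fun t => .smul _
      (.opMul (.opMul (.basic _) (M.fieldPoly_fPhi A)) (.basic _))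

theorem fieldPoly_gaugeFix (ξ : ℝ) (a : κ ⊕ ω) : FieldPoly (M.gaugeFix ξ a) := by
  refine FieldPoly.sub (.sum fun μ => .smul _ ((M.fieldPoly_fW a μ).pd μ)) (.smul _ ?_)
  cases a with
  | inl α => exact FieldPoly.smul (M.m α : ℂ) (.basic _)
  | inr _ => exact .zero

theorem fieldPoly_gfAction (ξ : ℝ) : FieldPoly (M.gfAction ξ) := by
  rw [gfAction, ← neg_smul]
  exact .smul _ (.sum fun a => (M.fieldPoly_gaugeFix ξ a).opMul (M.fieldPoly_gaugeFix ξ a))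

/-- Gauge invariance of the classical action. -/
theorem gaugeVar_invAction (b : κ ⊕ ω) (p : Momentum) : M.gaugeVar b p M.invAction = 0 := by
  rw [invAction, map_add, map_add, gaugeVar_lagYM, gaugeVar_lagScalar, gaugeVar_lagFermion,
    add_zero, add_zero]

theorem contr_invAction (b : κ ⊕ ω) (p : Momentum) :
    M.contr b p M.invAction = -M.rot b p M.invAction :=
  eq_neg_of_add_eq_zero_left (M.gaugeVar_invAction b p)

theorem contr_comm {F : Func κ ω η ν} (hF : EvenSymm F) (a b : κ ⊕ ω) (p q : Momentum) :
    M.contr b q (M.contr a p F) = M.contr a p (M.contr b q F) := by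
  have h : ∀ ℓ : Leg κ ω η ν, ℓ.field.isOdd = false →
      M.contr b q (legDeriv ℓ F) = legDeriv ℓ (M.contr b q F) := by
    intro ℓ hℓ
    funext L
    have h' : ∀ k : Leg κ ω η ν, k.field.isOdd = false → F (ℓ :: k :: L) = F (k :: ℓ :: L) :=
      fun k hk => congrFun (hF k ℓ hk hℓ) L
    change _ = M.contr b q F (ℓ :: L)
    simp only [contr_apply, legDeriv]
    rw [Finset.sum_congr rfl fun μ _ => by rw [h' ⟨.fld (.W b μ), q⟩ rfl],
      funext fun α => h' ⟨.fld (.scal (Sum.inl α)), q⟩ rfl]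
  have hm : ∀ X : κ → Func κ ω η ν, M.contrₗ b q (M.massGold a X) =
      M.massGold a fun α => M.contrₗ b q (X α) := fun X =>
    (M.massGold_map a ((M.contrₗ b q).restrictScalars ℝ) X).symm
  rw [← contrₗ_apply, contr, map_sub, hm, map_neg, map_smul, map_sum]
  have hW : ∀ μ, M.contr b q (legDeriv ⟨.fld (.W a μ), p⟩ F) = _ := fun μ => h _ rfl
  have hφ : ∀ α, M.contr b q (legDeriv ⟨.fld (.scal (Sum.inl α)), p⟩ F) = _ := fun α => h _ rfl
  simp only [map_smul, contrₗ_apply, hW, hφ]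
  rfl

/-- Insertion of `𝒟_a(p)` into the homogeneous part of a BRS vertex with ghost `c_b`. -/
noncomputable def insertion (a b : κ ⊕ ω) (p q : Momentum) (F : Func κ ω η ν) : Func κ ω η ν :=
  fun L => I * ∑ c, (M.f c a b : ℂ) * ∑ μ, (p μ : ℂ) * F (⟨.fld (.W c μ), q⟩ :: L)
    + M.massGold a fun α => ∑ Φ', M.brsMatrix b Φ' (.scal (Sum.inl α)) * F (⟨.fld Φ', q⟩ :: L)

/-- Contracting first makes the leg of `𝒟_a` the head of the list. The rotation then acts either on
the remaining legs, which commutes with the contraction, or on that leg itself. The latter gives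
`insertion`, its minus sign being the one in the definition of `𝒟_a`. -/
theorem contr_rot (a b : κ ⊕ ω) (p q : Momentum) (F : Func κ ω η ν) :
    M.contr a p (M.rot b q F) = M.rot b q (M.contr a p F) - M.insertion a b p (p + q) F := by
  have hm : ∀ X : κ → Func κ ω η ν, M.rot b q (M.massGold a X) =
      M.massGold a fun α => M.rot b q (X α) := fun X =>
    (M.massGold_map a ((M.rot b q).restrictScalars ℝ) X).symm
  have hW : ∀ (μ : Fin 4) (L : List (Leg κ ω η ν)), ∑ Φ', M.legMatrix b Φ' (.fld (.W a μ)) *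
      F (⟨.fld Φ', q + p⟩ :: L) = ∑ c, (M.f c a b : ℂ) * F (⟨.fld (.W c μ), p + q⟩ :: L) := by
    intro μ L
    rw [sum_fld]
    simp [legMatrix, brsMatrix, add_comm q p]
  funext L
  rw [contr_apply]
  simp only [rot_cons, hW, contr, insertion, map_sub, map_neg, map_smul, map_sum, hm,
    Pi.sub_apply, Pi.neg_apply, Pi.smul_apply, Finset.sum_apply, smul_eq_mul, massGold_apply,
    massGold_add, mul_add, Finset.sum_add_distrib]
  have hc : ∑ c, (M.f c a b : ℂ) * ∑ μ, (p μ : ℂ) * F (⟨.fld (.W c μ), p + q⟩ :: L) =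
      ∑ μ, (p μ : ℂ) * ∑ c, (M.f c a b : ℂ) * F (⟨.fld (.W c μ), p + q⟩ :: L) := by
    simp only [Finset.mul_sum]
    rw [Finset.sum_comm]
    exact Finset.sum_congr rfl fun _ _ => Finset.sum_congr rfl fun _ _ => by ring
  rw [hc, add_comm q p]
  simp only [legMatrix]
  ring

/-- The Ward identity for two contracted gauge bosons. -/
theorem contr_contr_invAction (a b : κ ⊕ ω) (p q : Momentum) :
    M.contr b q (M.contr a p M.invAction) =
      M.insertion a b p (p + q) M.invAction - M.rot b q (M.contr a p M.invAction) := by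
  rw [M.contr_comm M.fieldPoly_invAction.evenSymm, contr_invAction, ← contrₗ_apply, map_neg,
    contrₗ_apply, contr_rot]
  abel

theorem basic_opMul_eq_zero (Ψ : ClField κ ω η ν) (F : Func κ ω η ν) {L : List (Leg κ ω η ν)}
    (hL : ∀ ℓ ∈ L, ℓ.field ≠ Ψ) : (basic Ψ ⊠ F) L = 0 := by
  refine mulCoeff_eq_zero_of_left (P := fun ℓ => ℓ.field ≠ Ψ) ?_ F hL
  intro K hK
  rcases K with _ | ⟨ℓ, _ | ⟨k, K⟩⟩
  · rfl
  · simp [basic, hK ℓ (by simp)]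
  · rfl

/-- Every ghost or source term carries an antighost or a source as left factor, and such a factor
vanishes on lists of fields. -/
theorem treeAction_fld (ξ : ℝ) (L : List (Leg κ ω η ν)) (hL : ∀ ℓ ∈ L, ∃ Φ, ℓ.field = .fld Φ) :
    M.treeAction ξ L = M.invAction L + M.gfAction ξ L := by
  have h : ∀ (Ψ : ClField κ ω η ν) (F : Func κ ω η ν), (∀ Φ, ClField.fld Φ ≠ Ψ) →
      (basic Ψ ⊠ F) L = 0 := by
    refine fun Ψ F hΨ => basic_opMul_eq_zero Ψ F fun ℓ hℓ => ?_
    obtain ⟨Φ, hΦ⟩ := hL ℓ hℓ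
    exact hΦ ▸ hΨ Φ
  have h1 : ∀ a, (basic (.antighost a) ⊠ M.brsGaugeFix ξ a) L = 0 := fun a => h _ _ (by simp)
  have h2 : ∀ Φ, (basic (.src Φ) ⊠ M.brs Φ) L = 0 := fun a => h _ _ (by simp)
  have h3 : ∀ a, (basic (.ghostSrc a) ⊠ M.brsGhost a) L = 0 := fun a => h _ _ (by simp)
  simp only [treeAction, invAction, gfAction, Pi.add_apply, Pi.sub_apply, Pi.neg_apply,
    Finset.sum_apply, h1, h2, h3, Finset.sum_const_zero]
  ring

/-- The legs are in the order of the factors in `c̄ δG` and `Φ` is commuting, so the only sign is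
that of the ghost term in the action. -/
theorem treeAction_antighost_ghost (ξ : ℝ) (Φ : Fld κ ω η ν)
    (hΦ : (ClField.fld Φ).isOdd = false) (b c : κ ⊕ ω) (k pc pb : Momentum) :
    M.treeAction ξ [⟨.fld Φ, k⟩, ⟨.antighost c, pc⟩, ⟨.ghost b, pb⟩] =
      -M.brsGaugeFix ξ c [⟨.fld Φ, k⟩, ⟨.ghost b, pb⟩] := by
  have hS := M.fieldPoly_invAction.eq_zero_of_mem
    [⟨.fld Φ, k⟩, ⟨.antighost c, pc⟩, ⟨.ghost b, pb⟩] ⟨⟨.ghost b, pb⟩, by simp, by simp⟩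
  have hQ := (M.fieldPoly_gfAction ξ).eq_zero_of_mem
    [⟨.fld Φ, k⟩, ⟨.antighost c, pc⟩, ⟨.ghost b, pb⟩] ⟨⟨.ghost b, pb⟩, by simp, by simp⟩
  have h1 : ∀ a, (basic (.antighost a) ⊠ M.brsGaugeFix ξ a)
      [⟨.fld Φ, k⟩, ⟨.antighost c, pc⟩, ⟨.ghost b, pb⟩] =
        if c = a then M.brsGaugeFix ξ a [⟨.fld Φ, k⟩, ⟨.ghost b, pb⟩] else 0 := by
    intro a
    simp [opMul, mulCoeff, legDeriv, passSign, hΦ, basic]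
  have h2 : ∀ Ψ, (basic (.src Ψ) ⊠ M.brs Ψ)
      [⟨.fld Φ, k⟩, ⟨.antighost c, pc⟩, ⟨.ghost b, pb⟩] = 0 :=
    fun Ψ => basic_opMul_eq_zero _ _ (by simp)
  have h3 : ∀ a, (basic (.ghostSrc a) ⊠ M.brsGhost a)
      [⟨.fld Φ, k⟩, ⟨.antighost c, pc⟩, ⟨.ghost b, pb⟩] = 0 :=
    fun a => basic_opMul_eq_zero _ _ (by simp)
  simp only [invAction, gfAction, Pi.add_apply, Pi.neg_apply] at hS hQ
  simp only [treeAction, Pi.add_apply, Pi.sub_apply, Finset.sum_apply, h1, h2, h3,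
    Finset.sum_const_zero, Finset.sum_ite_eq, Finset.mem_univ, if_true]
  simp only [Finset.sum_apply, Pi.smul_apply] at hS hQ ⊢
  linear_combination hS + hQ

theorem gaugeFix_nil (ξ : ℝ) (a : κ ⊕ ω) : M.gaugeFix ξ a [] = 0 := by
  cases a <;> simp [gaugeFix, massGold, pd, fW, basic]

theorem gaugeFix_cons_cons (ξ : ℝ) (a : κ ⊕ ω) (ℓ k : Leg κ ω η ν) (L : List (Leg κ ω η ν)) :
    M.gaugeFix ξ a (ℓ :: k :: L) = 0 := by
  cases a <;> simp [gaugeFix, massGold, pd, fW, basic]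

theorem gaugeFix_W (ξ : ℝ) (a c : κ ⊕ ω) (ρ : Fin 4) (q : Momentum) :
    M.gaugeFix ξ a [⟨.fld (.W c ρ), q⟩] =
      if c = a then -I * ((eta ρ * q ρ : ℝ) : ℂ) else 0 := by
  have : M.gaugeFix ξ a [⟨.fld (.W c ρ), q⟩] =
      ∑ μ, (eta μ : ℂ) * pd μ (M.fW a μ) [⟨.fld (.W c ρ), q⟩] := by
    cases a <;> simp [gaugeFix, massGold, basic]
  rw [this]
  by_cases h : c = a
  · subst h
    rw [Finset.sum_eq_single ρ (by
      intro μ _ hμ; simp [pd, fW, basic, Ne.symm hμ]) (by simp)]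
    simp [pd, fW, basic, totalMom]; ring
  · simp [pd, fW, basic, h]

theorem gaugeFix_scal (ξ : ℝ) (a : κ ⊕ ω) (A : κ ⊕ η) (q : Momentum) :
    M.gaugeFix ξ a [⟨.fld (.scal A), q⟩] =
      -(ξ : ℂ) * M.massGold a fun α => if A = Sum.inl α then 1 else 0 := by
  simp [gaugeFix, pd, fW, basic, massGold_apply]

theorem gaugeFix_of_isOdd (ξ : ℝ) (a : κ ⊕ ω) (ℓ : Leg κ ω η ν) (h : ℓ.field.isOdd = true) :
    M.gaugeFix ξ a [ℓ] = 0 := by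
  have hW : ∀ μ, ℓ.field ≠ .fld (.W a μ) := by rintro μ e; rw [e] at h; simp [ClField.isOdd] at h
  have hφ : ∀ α, ℓ.field ≠ .fld (.scal α) := by rintro μ e; rw [e] at h; simp [ClField.isOdd] at h
  cases a <;> simp [gaugeFix, pd, fW, basic, massGold, hW, hφ]

theorem gfAction_three (ξ : ℝ) (ℓ₁ ℓ₂ ℓ₃ : Leg κ ω η ν) :
    M.gfAction ξ [ℓ₁, ℓ₂, ℓ₃] = 0 := by
  simp [gfAction, opMul, mulCoeff, legDeriv, passSign, gaugeFix_nil, gaugeFix_cons_cons]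

theorem gfAction_four (ξ : ℝ) (ℓ₁ ℓ₂ ℓ₃ ℓ₄ : Leg κ ω η ν) :
    M.gfAction ξ [ℓ₁, ℓ₂, ℓ₃, ℓ₄] = 0 := by
  simp [gfAction, opMul, mulCoeff, legDeriv, passSign, gaugeFix_nil, gaugeFix_cons_cons]

theorem gfAction_two (ξ : ℝ) (ℓ₁ ℓ₂ : Leg κ ω η ν) :
    M.gfAction ξ [ℓ₁, ℓ₂] = -((ξ : ℂ)⁻¹ * ∑ a, M.gaugeFix ξ a [ℓ₁] * M.gaugeFix ξ a [ℓ₂]) := by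
  have h : ∀ a, (M.gaugeFix ξ a ⊠ M.gaugeFix ξ a) [ℓ₁, ℓ₂] =
      2 * (M.gaugeFix ξ a [ℓ₁] * M.gaugeFix ξ a [ℓ₂]) := by
    intro a
    -- For an anticommuting leg both sides vanish, so the graded sign in the product never matters.
    by_cases h : ℓ₁.field.isOdd = true
    · simp [opMul, mulCoeff, legDeriv, passSign, gaugeFix_nil, gaugeFix_cons_cons,
        M.gaugeFix_of_isOdd ξ a ℓ₁ h]
    · simp [opMul, mulCoeff, legDeriv, passSign, gaugeFix_nil, gaugeFix_cons_cons, h]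
      ring
  simp only [gfAction, Pi.neg_apply, Pi.smul_apply, Finset.sum_apply, h, smul_eq_mul,
    ← Finset.mul_sum]
  rw [one_div, mul_inv]
  ring

end BrokenGaugeTheory

/-! ### One- and two-point vertices -/

section Products

variable {κ ω η ν : Type*}

theorem opMul_nil (F G : Func κ ω η ν) : (F ⊠ G) [] = F [] * G [] := rfl

theorem opMul_singleton (F G : Func κ ω η ν) (ℓ : Leg κ ω η ν) :
    (F ⊠ G) [ℓ] = F [ℓ] * G [] + F [] * G [ℓ] := by
  simp [opMul, mulCoeff, legDeriv, passSign]

theorem opMul_pair (F G : Func κ ω η ν) {ℓ₁ ℓ₂ : Leg κ ω η ν} (h₁ : ℓ₁.field.isOdd = false)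
    (h₂ : ℓ₂.field.isOdd = false) :
    (F ⊠ G) [ℓ₁, ℓ₂] =
      F [ℓ₁, ℓ₂] * G [] + F [ℓ₁] * G [ℓ₂] + F [ℓ₂] * G [ℓ₁] + F [] * G [ℓ₁, ℓ₂] := by
  simp [opMul, mulCoeff, legDeriv, passSign, h₁, h₂]
  ring

end Products

namespace BrokenGaugeTheory

variable {κ ω η ν : Type*} [Fintype κ] [Fintype ω] [Fintype η] [Fintype ν]
  [DecidableEq κ] [DecidableEq ω] [DecidableEq η] [DecidableEq ν]

variable (M : BrokenGaugeTheory κ ω η ν)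

theorem fW_nil (a : κ ⊕ ω) (μ : Fin 4) : M.fW a μ [] = 0 := rfl

theorem fPhi_nil (A : κ ⊕ η) : M.fPhi A [] = ((Sum.elim 0 M.v A : ℝ) : ℂ) := by
  simp [fPhi, opOne, basic]

theorem fPhi_singleton (A : κ ⊕ η) (ℓ : Leg κ ω η ν) :
    M.fPhi A [ℓ] = if ℓ.field = .fld (.scal A) then 1 else 0 := by
  simp [fPhi, opOne, basic]

theorem fPhi_cons_cons (A : κ ⊕ η) (ℓ k : Leg κ ω η ν) (L : List (Leg κ ω η ν)) :
    M.fPhi A (ℓ :: k :: L) = 0 := by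
  simp [fPhi, opOne, basic]

theorem fieldStrength_nil (a : κ ⊕ ω) (μ ρ : Fin 4) : M.fieldStrength a μ ρ [] = 0 := by
  simp [fieldStrength, pd, fW_nil, opMul_nil]

theorem fieldStrength_scal (a : κ ⊕ ω) (μ ρ : Fin 4) (A : κ ⊕ η) (q : Momentum) :
    M.fieldStrength a μ ρ [⟨.fld (.scal A), q⟩] = 0 := by
  simp [fieldStrength, pd, opMul_singleton, fW, basic]

theorem covPhi_nil (A : κ ⊕ η) (μ : Fin 4) : M.covPhi A μ [] = 0 := by
  simp [covPhi, pd, totalMom, fW_nil, opMul_nil]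

theorem covPhi_scal (A B : κ ⊕ η) (μ : Fin 4) (q : Momentum) :
    M.covPhi A μ [⟨.fld (.scal B), q⟩] = if B = A then -I * (q μ : ℂ) else 0 := by
  simp [covPhi, pd, totalMom, fPhi_singleton, opMul_singleton, fW, basic]

theorem covPhi_W (A : κ ⊕ η) (c : κ ⊕ ω) (μ ρ : Fin 4) (q : Momentum) :
    M.covPhi A μ [⟨.fld (.W c ρ), q⟩] =
      if ρ = μ then ((∑ j, M.T c A (Sum.inr j) * M.v j : ℝ) : ℂ) else 0 := by
  have : ∀ a B, (M.fW a μ ⊠ M.fPhi B) [⟨.fld (.W c ρ), q⟩] =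
      if c = a ∧ ρ = μ then ((Sum.elim 0 M.v B : ℝ) : ℂ) else 0 := by
    intro a B
    rw [opMul_singleton, fW_nil, fPhi_nil, fW, basic]
    simp
  simp only [covPhi, Pi.add_apply, pd, fPhi_singleton, Finset.sum_apply, Pi.smul_apply, this,
    smul_eq_mul]
  by_cases h : ρ = μ
  · simp [h]
  · simp [h]

theorem covPsi_nil (i : ν) (s μ : Fin 4) : M.covPsi i s μ [] = 0 := by
  simp [covPsi, pd, totalMom, fW_nil, opMul_nil]

theorem lagPotential_singleton (ℓ : Leg κ ω η ν) : M.lagPotential [ℓ] = 0 := by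
  set w : κ ⊕ η → ℝ := Sum.elim 0 M.v with hw
  set e : κ ⊕ η → ℂ := fun A => M.fPhi A [ℓ] with he
  have h : M.lagPotential [ℓ] = ∑ A, e A * (gradPotential M.g2 M.g3 M.g4 w A : ℂ) := by
    have q1 : ∑ A, ∑ B, (M.g2 A B : ℂ) * (w A * e B) = ∑ A, ∑ B, (M.g2 A B : ℂ) * (e A * w B) := by
      rw [Finset.sum_comm]
      exact Finset.sum_congr rfl fun A _ => Finset.sum_congr rfl fun B _ => by
        rw [M.g2_symm A B]; ring
    have c1 : ∑ A, ∑ B, ∑ C, (M.g3 A B C : ℂ) * (w A * e B * w C) =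
        ∑ A, ∑ B, ∑ C, (M.g3 A B C : ℂ) * (e A * w B * w C) := by
      rw [Finset.sum_comm]
      exact Finset.sum_congr rfl fun A _ => Finset.sum_congr rfl fun B _ =>
        Finset.sum_congr rfl fun C _ => by rw [(M.g3_symm A B C).1]; ring
    have c2 : ∑ A, ∑ B, ∑ C, (M.g3 A B C : ℂ) * (w A * w B * e C) =
        ∑ A, ∑ B, ∑ C, (M.g3 A B C : ℂ) * (w A * e B * w C) := by
      refine Finset.sum_congr rfl fun A _ => ?_
      rw [Finset.sum_comm]
      exact Finset.sum_congr rfl fun B _ =>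
        Finset.sum_congr rfl fun C _ => by rw [(M.g3_symm A B C).2]; ring
    have d1 : ∑ A, ∑ B, ∑ C, ∑ D, (M.g4 A B C D : ℂ) * (w A * e B * w C * w D) =
        ∑ A, ∑ B, ∑ C, ∑ D, (M.g4 A B C D : ℂ) * (e A * w B * w C * w D) := by
      rw [Finset.sum_comm]
      exact Finset.sum_congr rfl fun A _ => Finset.sum_congr rfl fun B _ =>
        Finset.sum_congr rfl fun C _ => Finset.sum_congr rfl fun D _ => by
          rw [(M.g4_symm A B C D).1]; ring
    have d2 : ∑ A, ∑ B, ∑ C, ∑ D, (M.g4 A B C D : ℂ) * (w A * w B * e C * w D) =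
        ∑ A, ∑ B, ∑ C, ∑ D, (M.g4 A B C D : ℂ) * (w A * e B * w C * w D) := by
      refine Finset.sum_congr rfl fun A _ => ?_
      rw [Finset.sum_comm]
      exact Finset.sum_congr rfl fun B _ =>
        Finset.sum_congr rfl fun C _ => Finset.sum_congr rfl fun D _ => by
          rw [(M.g4_symm A B C D).2.1]; ring
    have d3 : ∑ A, ∑ B, ∑ C, ∑ D, (M.g4 A B C D : ℂ) * (w A * w B * w C * e D) =
        ∑ A, ∑ B, ∑ C, ∑ D, (M.g4 A B C D : ℂ) * (w A * w B * e C * w D) := by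
      refine Finset.sum_congr rfl fun A _ => Finset.sum_congr rfl fun B _ => ?_
      rw [Finset.sum_comm]
      exact Finset.sum_congr rfl fun C _ => Finset.sum_congr rfl fun D _ => by
          rw [(M.g4_symm A B C D).2.2]; ring
    have l2 : ∀ A B, (M.fPhi A ⊠ M.fPhi B) [ℓ] = e A * w B + w A * e B := by
      intro A B
      simp only [opMul_singleton, fPhi_nil, he, hw]
    have l3 : ∀ A B C, (M.fPhi A ⊠ M.fPhi B ⊠ M.fPhi C) [ℓ] =
        e A * w B * w C + w A * e B * w C + w A * w B * e C := by
      intro A B C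
      simp only [opMul_singleton, opMul_nil, fPhi_nil, he, hw]; ring
    have l4 : ∀ A B C D, (M.fPhi A ⊠ M.fPhi B ⊠ M.fPhi C ⊠ M.fPhi D) [ℓ] =
        e A * w B * w C * w D + w A * e B * w C * w D + w A * w B * e C * w D
          + w A * w B * w C * e D := by
      intro A B C D
      simp only [opMul_singleton, opMul_nil, fPhi_nil, he, hw]; ring
    simp only [lagPotential, Pi.add_apply, Pi.smul_apply, Finset.sum_apply, smul_eq_mul, l2, l3,
      l4, mul_add, Finset.sum_add_distrib]
    -- By symmetry of the coefficients, the terms with the leg in different positions agree. The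
    -- resulting factors 2, 3 and 4 turn the prefactors 1/2, 1/6 and 1/24 into the 1, 1/2 and 1/6 of
    -- the gradient.
    rw [q1, c2, c1, d3, d2, d1]
    simp only [gradPotential, Complex.ofReal_add, Complex.ofReal_mul, Complex.ofReal_sum, mul_add,
      Finset.sum_add_distrib, Finset.mul_sum, Complex.ofReal_div, Complex.ofReal_one,
      Complex.ofReal_ofNat]
    simp only [← Finset.sum_add_distrib]
    refine Finset.sum_congr rfl fun A _ => Finset.sum_congr rfl fun B _ => ?_
    congr 1
    · congr 1
      · ring
      · exact Finset.sum_congr rfl fun C _ => by ring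
    · exact Finset.sum_congr rfl fun C _ => Finset.sum_congr rfl fun D _ => by ring
  rw [h]
  simp [hw, M.potential_vac]

/-- The classical action is stationary at the vacuum. -/
theorem invAction_singleton (ℓ : Leg κ ω η ν) : M.invAction [ℓ] = 0 := by
  have hψ : ∀ i s, M.fpsi i s [] = 0 := fun _ _ => rfl
  have hψ' : ∀ i s, M.fpsibar i s [] = 0 := fun _ _ => rfl
  simp [invAction, lagYM, lagScalar, lagFermion, lagPotential_singleton, opMul_singleton,
    opMul_nil, fieldStrength_nil, covPhi_nil, covPsi_nil, hψ, hψ']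

theorem lagPotential_scal_W (A : κ ⊕ η) (c : κ ⊕ ω) (ρ : Fin 4) (q q' : Momentum) :
    M.lagPotential [⟨.fld (.scal A), q⟩, ⟨.fld (.W c ρ), q'⟩] = 0 := by
  have hp : ∀ F G : Func κ ω η ν,
      (F ⊠ G) [⟨.fld (.scal A), q⟩, ⟨.fld (.W c ρ), q'⟩] = _ := fun F G =>
    opMul_pair F G rfl rfl
  have hW : ∀ B, M.fPhi B [⟨.fld (.W c ρ), q'⟩] = 0 := fun B => by simp [fPhi_singleton]
  simp [lagPotential, hp, fPhi_cons_cons, hW, opMul_singleton]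

theorem lagFermion_scal_W (A : κ ⊕ η) (c : κ ⊕ ω) (ρ : Fin 4) (q q' : Momentum) :
    M.lagFermion [⟨.fld (.scal A), q⟩, ⟨.fld (.W c ρ), q'⟩] = 0 := by
  have hp : ∀ F G : Func κ ω η ν,
      (F ⊠ G) [⟨.fld (.scal A), q⟩, ⟨.fld (.W c ρ), q'⟩] = _ := fun F G =>
    opMul_pair F G rfl rfl
  simp [lagFermion, hp, opMul_singleton, opMul_nil, fpsibar, fpsi, basic]

/-- Only the scalar kinetic term mixes: it contributes the cross term of `∂Φ_A` with `T^c v W_c`. -/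
theorem invAction_scal_W (A : κ ⊕ η) (c : κ ⊕ ω) (ρ : Fin 4) (q q' : Momentum) :
    M.invAction [⟨.fld (.scal A), q⟩, ⟨.fld (.W c ρ), q'⟩] =
      -I * ((eta ρ * q ρ * ∑ j, M.T c A (Sum.inr j) * M.v j : ℝ) : ℂ) := by
  have hp : ∀ F G : Func κ ω η ν,
      (F ⊠ G) [⟨.fld (.scal A), q⟩, ⟨.fld (.W c ρ), q'⟩] = _ := fun F G =>
    opMul_pair F G rfl rfl
  have hYM : M.lagYM [⟨.fld (.scal A), q⟩, ⟨.fld (.W c ρ), q'⟩] = 0 := by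
    simp [lagYM, hp, fieldStrength_nil, fieldStrength_scal]
  have hS : M.lagScalar [⟨.fld (.scal A), q⟩, ⟨.fld (.W c ρ), q'⟩] =
      -I * ((eta ρ * q ρ * ∑ j, M.T c A (Sum.inr j) * M.v j : ℝ) : ℂ) := by
    simp only [lagScalar, Pi.sub_apply, lagPotential_scal_W, sub_zero, Pi.smul_apply,
      Finset.sum_apply, smul_eq_mul, hp, covPhi_nil, covPhi_scal, covPhi_W]
    rw [Finset.sum_eq_single A (by intro B _ h; simp [Ne.symm h]) (by simp),
      Finset.sum_eq_single ρ (by intro μ _ h; simp [Ne.symm h]) (by simp)]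
    simp only [if_true]
    push_cast; ring
  rw [invAction, Pi.add_apply, Pi.add_apply, hYM, hS, lagFermion_scal_W]
  ring

/-- In the `R_ξ` gauges scalars do not mix with gauge bosons. -/
theorem invAction_add_gfAction_scal_W {ξ : ℝ} (hξ : ξ ≠ 0) (A : κ ⊕ η) (c : κ ⊕ ω) (ρ : Fin 4)
    (q q' : Momentum) (hq : q + q' = 0) :
    M.invAction [⟨.fld (.scal A), q⟩, ⟨.fld (.W c ρ), q'⟩]
      + M.gfAction ξ [⟨.fld (.scal A), q⟩, ⟨.fld (.W c ρ), q'⟩] = 0 := by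
  have hξ' : (ξ : ℂ) ≠ 0 := Complex.ofReal_ne_zero.2 hξ
  have hq' : q = -q' := eq_neg_of_add_eq_zero_left hq
  -- Both mixing terms are expressed through `(T^c v)_A`. The `ξ` in the gauge fixing function
  -- cancels the prefactor `1/ξ`, and the relative sign comes from `q = -q'`.
  have hm : (M.massGold c fun α => if A = Sum.inl α then (1 : ℂ) else 0) =
      ((∑ j, M.T c A (Sum.inr j) * M.v j : ℝ) : ℂ) := by
    rcases A with α | i
    · rw [M.vac_gold]
      rcases c with γ | γ
      · by_cases h : γ = α
        · subst h; simp [massGold]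
        · simp [massGold, h, Ne.symm h]
      · simp [massGold]
    · rw [M.vac_higgs]; simp [massGold_zero]
  rw [invAction_scal_W, gfAction_two]
  simp only [gaugeFix_W, gaugeFix_scal]
  rw [Finset.sum_eq_single c (by intro a _ h; simp [Ne.symm h]) (by simp), if_pos rfl, hm, hq']
  simp only [Pi.neg_apply]
  push_cast
  field_simp
  ring

theorem rot_singleton (b : κ ⊕ ω) (p : Momentum) (F : Func κ ω η ν) (Φ : Fld κ ω η ν)
    (k : Momentum) :
    M.rot b p F [⟨.fld Φ, k⟩] = ∑ Φ', M.brsMatrix b Φ' Φ * F [⟨.fld Φ', p + k⟩] :=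
  add_zero _

/-- By gauge invariance the contraction is a combination of one-point vertices, which vanish at the
stationary vacuum. -/
theorem contr_invAction_singleton (a : κ ⊕ ω) (p k : Momentum) (Φ : Fld κ ω η ν) :
    M.contr a p M.invAction [⟨.fld Φ, k⟩] = 0 := by
  rw [contr_invAction, Pi.neg_apply, rot_singleton]
  simp [invAction_singleton]

/-- Higgs fields do not mix with Goldstone bosons. -/
theorem invAction_higgs_gold (i : η) (γ : κ) (q q' : Momentum) :
    M.invAction [⟨.fld (.scal (Sum.inr i)), q⟩, ⟨.fld (.scal (Sum.inl γ)), q'⟩] = 0 := by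
  -- The mixing is read off from the contracted two-point vertex instead of the Hessian: its gauge
  -- boson part is proportional to `(T^γ v)_i = 0`, leaving `m_γ` times the mixing, with `m_γ ≠ 0`.
  have h := M.contr_invAction_singleton (Sum.inl γ) q' q (.scal (Sum.inr i))
  have hswap : ∀ Ψ : ClField κ ω η ν, Ψ.isOdd = false →
      M.invAction [⟨Ψ, q'⟩, ⟨.fld (.scal (Sum.inr i)), q⟩] =
        M.invAction [⟨.fld (.scal (Sum.inr i)), q⟩, ⟨Ψ, q'⟩] := fun Ψ hΨ =>
    congrFun (M.fieldPoly_invAction.evenSymm _ _ rfl hΨ) []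
  rw [contr_apply] at h
  simp only [massGold] at h
  rw [hswap _ rfl, Finset.sum_congr rfl fun μ _ => by rw [hswap _ rfl, invAction_scal_W]] at h
  simp only [M.vac_higgs] at h
  have hm : (M.m γ : ℂ) ≠ 0 := Complex.ofReal_ne_zero.2 (M.m_pos γ).ne'
  simpa [hm] using h

theorem contr_contr_invAction_singleton (a b : κ ⊕ ω) (p q k : Momentum) (Φ : Fld κ ω η ν) :
    M.contr b q (M.contr a p M.invAction) [⟨.fld Φ, k⟩] =
      M.insertion a b p (p + q) M.invAction [⟨.fld Φ, k⟩] := by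
  rw [contr_contr_invAction, Pi.sub_apply, rot_singleton]
  simp [contr_invAction_singleton]


end BrokenGaugeTheory

/-! ### Ghost vertices and the identities for tree vertices -/

namespace BrokenGaugeTheory

variable {κ ω η ν : Type*} [Fintype κ] [Fintype ω] [Fintype η] [Fintype ν]
  [DecidableEq κ] [DecidableEq ω] [DecidableEq η] [DecidableEq ν]

variable (M : BrokenGaugeTheory κ ω η ν)

/-- The coefficients of the fields in the insertion of `𝒟_a(p)` into a BRS vertex. -/
noncomputable def insertionCoeff (a b : κ ⊕ ω) (p : Momentum) (Φ : Fld κ ω η ν) : ℂ :=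
  (match Φ with
    | .W c μ => I * (M.f c a b : ℂ) * (p μ : ℂ)
    | _ => 0) + M.massGold a fun α => M.brsMatrix b Φ (.scal (Sum.inl α))

theorem insertion_eq_sum (a b : κ ⊕ ω) (p q : Momentum) (F : Func κ ω η ν)
    (L : List (Leg κ ω η ν)) :
    M.insertion a b p q F L = ∑ Φ, M.insertionCoeff a b p Φ * F (⟨.fld Φ, q⟩ :: L) := by
  simp only [insertion, insertionCoeff, add_mul, Finset.sum_add_distrib, massGold_sum,
    massGold_mul_right]
  congr 1
  rw [sum_fld]
  simp only [zero_mul, Finset.sum_const_zero, add_zero, Finset.mul_sum, mul_assoc]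

/-- The two-point gauge fixing coefficient is a sum of products of the values of `G_e` on the two
legs, and an insertion acts linearly on the first leg only. -/
theorem insertion_gfAction (ξ : ℝ) (a b : κ ⊕ ω) (p q : Momentum) (ℓ : Leg κ ω η ν) :
    M.insertion a b p q (M.gfAction ξ) [ℓ] =
      -((ξ : ℂ)⁻¹ * ∑ e, M.insertion a b p q (M.gaugeFix ξ e) [] * M.gaugeFix ξ e [ℓ]) := by
  simp only [insertion_eq_sum, gfAction_two, mul_neg, Finset.sum_neg_distrib, Finset.mul_sum,
    Finset.sum_mul]
  rw [Finset.sum_comm]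
  congr 1
  exact Finset.sum_congr rfl fun _ _ => Finset.sum_congr rfl fun _ _ => by ring

theorem contr_congr {F G : Func κ ω η ν} (a : κ ⊕ ω) (p : Momentum) {L : List (Leg κ ω η ν)}
    (h : ∀ Φ, F (⟨.fld Φ, p⟩ :: L) = G (⟨.fld Φ, p⟩ :: L)) :
    M.contr a p F L = M.contr a p G L := by
  simp only [contr_apply, h]

/-- With only fields as external legs the ghost and source terms are absent, and by `hgf` so is the
gauge fixing term. This transfers the Ward identity of the invariant action to tree vertices. -/
theorem contr_contr_treeVertex (ξ : ℝ) (a b : κ ⊕ ω) (pa pb : Momentum)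
    (L : List (Leg κ ω η ν)) (hL : ∀ ℓ ∈ L, ∃ Φ, ℓ.field = .fld Φ)
    (hgf : ∀ ℓ₁ ℓ₂, M.gfAction ξ (ℓ₁ :: ℓ₂ :: L) = 0) :
    M.contr b pb (M.contr a pa (M.treeVertex ξ)) L =
      I * M.contr b pb (M.contr a pa M.invAction) L := by
  have hs : ∀ (c : κ ⊕ ω) (p : Momentum) (F : Func κ ω η ν),
      M.contr c p (I • F) = I • M.contr c p F := fun c p F => (M.contrₗ c p).map_smul I F
  rw [← smul_eq_mul, ← Pi.smul_apply, ← hs, ← hs]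
  refine M.contr_congr b pb fun Φ₁ => M.contr_congr a pa fun Φ₂ => ?_
  rw [treeVertex, treeAction_fld, hgf, add_zero]
  · rfl
  · intro ℓ hℓ
    rcases List.mem_cons.1 hℓ with rfl | hℓ
    · exact ⟨_, rfl⟩
    rcases List.mem_cons.1 hℓ with rfl | hℓ
    · exact ⟨_, rfl⟩
    exact hL ℓ hℓ

theorem brsGaugeFix_W_ghost (ξ : ℝ) (a b c : κ ⊕ ω) (μ : Fin 4) (pa pb : Momentum) :
    M.brsGaugeFix ξ c [⟨.fld (.W a μ), pa⟩, ⟨.ghost b, pb⟩] =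
      -I * ((eta μ * (pa + pb) μ * M.f c a b : ℝ) : ℂ) := by
  have hφ : ∀ A, M.brs (.scal A) [⟨.fld (.W a μ), pa⟩, ⟨.ghost b, pb⟩] = 0 := by
    intro A
    simp [-Fintype.sum_sum_type, brs, opMul, mulCoeff, legDeriv, passSign, ClField.isOdd, fc,
      fPhi, basic, opOne]
  have hW : ∀ ρ, M.brs (.W c ρ) [⟨.fld (.W a μ), pa⟩, ⟨.ghost b, pb⟩] =
      if μ = ρ then (M.f c a b : ℂ) else 0 := by
    intro ρ
    by_cases h : μ = ρ
    · simp [-Fintype.sum_sum_type, brs, opMul, mulCoeff, legDeriv, passSign, ClField.isOdd, fc,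
        fW, basic, pd, h]
    · simp [-Fintype.sum_sum_type, brs, opMul, mulCoeff, legDeriv, passSign, ClField.isOdd, fc,
        fW, basic, pd, h]
  simp only [brsGaugeFix, Pi.sub_apply, Finset.sum_apply, Pi.smul_apply, massGold_apply, hφ,
    massGold_zero, smul_eq_mul, pd, hW]
  rw [Finset.sum_eq_single μ (by intro ρ _ h; simp [Ne.symm h]) (by simp)]
  simp [totalMom]
  ring

theorem brsGaugeFix_scal_ghost (ξ : ℝ) (b c : κ ⊕ ω) (A : κ ⊕ η) (pa pb : Momentum) :
    M.brsGaugeFix ξ c [⟨.fld (.scal A), pa⟩, ⟨.ghost b, pb⟩] =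
      (ξ : ℂ) * M.massGold c fun γ => (M.T b (Sum.inl γ) A : ℂ) := by
  have hφ : ∀ B, M.brs (.scal B) [⟨.fld (.scal A), pa⟩, ⟨.ghost b, pb⟩] = -(M.T b B A : ℂ) := by
    intro B
    simp [-Fintype.sum_sum_type, brs, opMul, mulCoeff, legDeriv, passSign, ClField.isOdd, fc,
      fPhi, basic, opOne]
  have hW : ∀ ρ, M.brs (.W c ρ) [⟨.fld (.scal A), pa⟩, ⟨.ghost b, pb⟩] = 0 := by
    intro ρ
    simp [-Fintype.sum_sum_type, brs, opMul, mulCoeff, legDeriv, passSign, ClField.isOdd, fc,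
        fW, basic, pd]
  simp only [brsGaugeFix, Pi.sub_apply, Finset.sum_apply, Pi.smul_apply, massGold_apply, hφ,
    massGold_neg, smul_eq_mul, pd, hW, mul_zero, Finset.sum_const_zero]
  ring

/-- The ghost vertex contracted with `𝒟_a` in terms of the gauge fixing function. -/
theorem contr_treeVertex_ghost (ξ : ℝ) (a b c : κ ⊕ ω) (pa pb pc : Momentum) :
    M.contr a pa (M.treeVertex ξ) [⟨.antighost c, pc⟩, ⟨.ghost b, pb⟩] =
      I * M.insertion a b pa (pa + pb) (M.gaugeFix ξ c) [] := by
  have hW : ∀ μ, M.treeVertex ξ [⟨.fld (.W a μ), pa⟩, ⟨.antighost c, pc⟩, ⟨.ghost b, pb⟩] =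
      I * (I * ((eta μ * (pa + pb) μ * M.f c a b : ℝ) : ℂ)) := by
    intro μ
    rw [treeVertex, treeAction_antighost_ghost _ _ _ rfl, brsGaugeFix_W_ghost]
    ring
  have hφ : ∀ A, M.treeVertex ξ [⟨.fld (.scal A), pa⟩, ⟨.antighost c, pc⟩, ⟨.ghost b, pb⟩] =
      -(I * ξ * M.massGold c fun γ => (M.T b (Sum.inl γ) A : ℂ)) := by
    intro A
    rw [treeVertex, treeAction_antighost_ghost _ _ _ rfl, brsGaugeFix_scal_ghost]
    ring
  -- Evaluating the linear function `G_c` on the rotated Goldstone boson reproduces the coefficient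
  -- in its BRS variation. The minus sign of the ghost action and that of `𝒟_a` cancel.
  have hg : ∀ α, ∑ Φ', M.brsMatrix b Φ' (.scal (Sum.inl α)) *
      M.gaugeFix ξ c [⟨.fld Φ', pa + pb⟩] =
        (ξ : ℂ) * M.massGold c fun γ => (M.T b (Sum.inl γ) (Sum.inl α) : ℂ) := by
    intro α
    rw [sum_fld]
    simp only [brsMatrix, zero_mul, Finset.sum_const_zero, zero_add, add_zero, gaugeFix_scal]
    cases c with
    | inl γ =>
      simp only [massGold]
      rw [Finset.sum_eq_single (Sum.inl γ) (by intro A _ h; simp [h]) (by simp)]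
      simp; ring
    | inr _ => simp [massGold]
  rw [contr_apply, insertion]
  simp only [hW, hφ, hg, gaugeFix_W, massGold_neg, massGold_mul_left]
  rw [Finset.sum_eq_single c (by intro d _ h; simp [h]) (by simp)]
  simp only [if_true]
  have : ∑ μ, (pa μ : ℂ) * (I * (I * ((eta μ * (pa + pb) μ * M.f c a b : ℝ) : ℂ))) =
      -((M.f c a b : ℂ) * I * ∑ μ, (pa μ : ℂ) * (-I * ((eta μ * (pa + pb) μ : ℝ) : ℂ))) := by
    rw [Finset.mul_sum, ← Finset.sum_neg_distrib]
    exact Finset.sum_congr rfl fun _ _ => by push_cast; ring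
  rw [this]
  ring

theorem treeVertex_pair (ξ : ℝ) (Φ₁ Φ₂ : Fld κ ω η ν) (k₁ k₂ : Momentum) :
    M.treeVertex ξ [⟨.fld Φ₁, k₁⟩, ⟨.fld Φ₂, k₂⟩] =
      I * (M.invAction [⟨.fld Φ₁, k₁⟩, ⟨.fld Φ₂, k₂⟩]
        + M.gfAction ξ [⟨.fld Φ₁, k₁⟩, ⟨.fld Φ₂, k₂⟩]) := by
  rw [treeVertex, treeAction_fld]
  intro ℓ hℓ
  simp only [List.mem_cons, List.not_mem_nil, or_false] at hℓ
  rcases hℓ with rfl | rfl <;> exact ⟨_, rfl⟩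

/-- The identity for all three-point vertices with two contracted gauge bosons. -/
theorem contr_contr_treeVertex_singleton (ξ : ℝ) (a b : κ ⊕ ω) (pa pb k : Momentum)
    (Φ : Fld κ ω η ν) :
    M.contr b pb (M.contr a pa (M.treeVertex ξ)) [⟨.fld Φ, k⟩] =
      M.insertion a b pa (pa + pb) (M.treeVertex ξ) [⟨.fld Φ, k⟩]
        + (ξ : ℂ)⁻¹ * ∑ e, M.contr a pa (M.treeVertex ξ) [⟨.antighost e, k⟩, ⟨.ghost b, pb⟩] *
          M.gaugeFix ξ e [⟨.fld Φ, k⟩] := by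
  rw [contr_contr_treeVertex _ _ _ _ _ _ _ (by simp) fun ℓ₁ ℓ₂ => M.gfAction_three ξ ℓ₁ ℓ₂ _,
    contr_contr_invAction_singleton]
  -- The insertion into the tree vertex exceeds that into the invariant action by the gauge fixing
  -- part. Moving this excess to the other side produces the ghost term.
  have h : M.insertion a b pa (pa + pb) (M.treeVertex ξ) [⟨.fld Φ, k⟩] =
      I * (M.insertion a b pa (pa + pb) M.invAction [⟨.fld Φ, k⟩]
        + M.insertion a b pa (pa + pb) (M.gfAction ξ) [⟨.fld Φ, k⟩]) := by
    simp only [insertion_eq_sum, treeVertex_pair, ← Finset.sum_add_distrib, Finset.mul_sum]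
    exact Finset.sum_congr rfl fun _ _ => by ring
  rw [h, insertion_gfAction]
  simp only [contr_treeVertex_ghost, mul_assoc, ← Finset.mul_sum]
  ring

/-- The identity for all four-point vertices with two contracted gauge bosons. -/
theorem contr_contr_treeVertex_pair (ξ : ℝ) (a b : κ ⊕ ω) (pa pb k₁ k₂ : Momentum)
    (Φ₁ Φ₂ : Fld κ ω η ν) :
    M.contr b pb (M.contr a pa (M.treeVertex ξ)) [⟨.fld Φ₁, k₁⟩, ⟨.fld Φ₂, k₂⟩] =
      M.insertion a b pa (pa + pb) (M.treeVertex ξ) [⟨.fld Φ₁, k₁⟩, ⟨.fld Φ₂, k₂⟩]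
        - ∑ Φ', M.brsMatrix b Φ' Φ₁ *
            M.contr a pa (M.treeVertex ξ) [⟨.fld Φ', pb + k₁⟩, ⟨.fld Φ₂, k₂⟩]
        - ∑ Φ', M.brsMatrix b Φ' Φ₂ *
            M.contr a pa (M.treeVertex ξ) [⟨.fld Φ₁, k₁⟩, ⟨.fld Φ', pb + k₂⟩] := by
  have hV : ∀ (Ψ₁ Ψ₂ Ψ₃ : Fld κ ω η ν) (q₁ q₂ q₃ : Momentum),
      M.treeVertex ξ [⟨.fld Ψ₁, q₁⟩, ⟨.fld Ψ₂, q₂⟩, ⟨.fld Ψ₃, q₃⟩] =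
        I * M.invAction [⟨.fld Ψ₁, q₁⟩, ⟨.fld Ψ₂, q₂⟩, ⟨.fld Ψ₃, q₃⟩] := by
    intro Ψ₁ Ψ₂ Ψ₃ q₁ q₂ q₃
    rw [treeVertex, treeAction_fld, gfAction_three, add_zero]
    intro ℓ hℓ
    simp only [List.mem_cons, List.not_mem_nil, or_false] at hℓ
    rcases hℓ with rfl | rfl | rfl <;> exact ⟨_, rfl⟩
  have hc : ∀ (Ψ₁ Ψ₂ : Fld κ ω η ν) (q₁ q₂ : Momentum),
      M.contr a pa (M.treeVertex ξ) [⟨.fld Ψ₁, q₁⟩, ⟨.fld Ψ₂, q₂⟩] =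
        I * M.contr a pa M.invAction [⟨.fld Ψ₁, q₁⟩, ⟨.fld Ψ₂, q₂⟩] := by
    intro Ψ₁ Ψ₂ q₁ q₂
    have hs : M.contr a pa (I • M.invAction) = I • M.contr a pa M.invAction :=
      (M.contrₗ a pa).map_smul I _
    rw [← smul_eq_mul, ← Pi.smul_apply, ← hs]
    exact M.contr_congr a pa fun Φ => hV _ _ _ _ _ _
  have hr : M.rot b pb (M.contr a pa M.invAction) [⟨.fld Φ₁, k₁⟩, ⟨.fld Φ₂, k₂⟩] =
      ∑ Φ', M.brsMatrix b Φ' Φ₁ *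
            M.contr a pa M.invAction [⟨.fld Φ', pb + k₁⟩, ⟨.fld Φ₂, k₂⟩]
        + ∑ Φ', M.brsMatrix b Φ' Φ₂ *
            M.contr a pa M.invAction [⟨.fld Φ₁, k₁⟩, ⟨.fld Φ', pb + k₂⟩] := by
    rw [rot_cons, rot_singleton]
    rfl
  rw [contr_contr_treeVertex _ _ _ _ _ _ _ (by simp) fun ℓ₁ ℓ₂ => M.gfAction_four ξ ℓ₁ ℓ₂ _ _,
    contr_contr_invAction, Pi.sub_apply, hr]
  simp only [insertion_eq_sum, hV, hc, mul_left_comm _ I, ← Finset.mul_sum]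
  ring

/-- The functional derivative of the Zinn-Justin density in the direction of `𝒟_a`. -/
theorem contr_zjDensity (ξ : ℝ) (Γ : Func κ ω η ν) (a : κ ⊕ ω) (p : Momentum) :
    M.contr a p (M.zjDensity ξ Γ) =
      ∑ Φ, (M.contr a p (funDeriv (.src Φ) Γ) ⊠ funDeriv (.fld Φ) Γ
            + funDeriv (.src Φ) Γ ⊠ M.contr a p (funDeriv (.fld Φ) Γ))
          + ∑ c, (M.contr a p (funDeriv (.ghostSrc c) Γ) ⊠ funDeriv (.ghost c) Γ
            + funDeriv (.ghostSrc c) Γ ⊠ M.contr a p (funDeriv (.ghost c) Γ))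
          + ∑ b, (M.contr a p (M.auxB ξ b) ⊠ funDeriv (.antighost b) Γ
            + M.auxB ξ b ⊠ M.contr a p (funDeriv (.antighost b) Γ)) := by
  rw [zjDensity, ← contrₗ_apply]
  simp only [map_add, map_sum, contrₗ_apply, contr_opMul]

end BrokenGaugeTheory

end SBGT

theorem mainTheorem6 {κ ω η ν : Type*} [Fintype κ] [Fintype ω] [Fintype η] [Fintype ν]
    [DecidableEq κ] [DecidableEq ω] [DecidableEq η] [DecidableEq ν]
    (M : BrokenGaugeTheory κ ω η ν) (ξ : ℝ) (hξ : ξ ≠ 0) :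
    -- the Zinn-Justin equation, acted upon with `𝒟_a(p)`
    (∀ Γ : Func κ ω η ν, M.ZinnJustin ξ Γ →
      ∀ (a : κ ⊕ ω) (p : Momentum) (L : List (Leg κ ω η ν)), p + totalMom L = 0 →
        (∑ Φ, (M.contr a p (funDeriv (.src Φ) Γ) ⊠ funDeriv (.fld Φ) Γ
            + funDeriv (.src Φ) Γ ⊠ M.contr a p (funDeriv (.fld Φ) Γ))
          + ∑ c, (M.contr a p (funDeriv (.ghostSrc c) Γ) ⊠ funDeriv (.ghost c) Γ
            + funDeriv (.ghostSrc c) Γ ⊠ M.contr a p (funDeriv (.ghost c) Γ))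
          + ∑ b, (M.contr a p (M.auxB ξ b) ⊠ funDeriv (.antighost b) Γ
            + M.auxB ξ b ⊠ M.contr a p (funDeriv (.antighost b) Γ))) L = 0) ∧
    -- tree-level three-point vertices with a Higgs boson or a fermion
    (∀ (a b : κ ⊕ ω) (pa pb k : Momentum) (Φ : Fld κ ω η ν), pa + pb + k = 0 →
      ((∃ i, Φ = .scal (Sum.inr i)) ∨ (∃ i s, Φ = .psi i s) ∨ ∃ i s, Φ = .psibar i s) →
      M.contr b pb (M.contr a pa (M.treeVertex ξ)) [⟨.fld Φ, k⟩] =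
        Complex.I * ∑ c, (M.f c a b : ℂ) * ∑ μ, (pa μ : ℂ) *
            M.treeVertex ξ [⟨.fld (.W c μ), pa + pb⟩, ⟨.fld Φ, k⟩]
          + M.massGold a fun α => ∑ Φ', M.brsMatrix b Φ' (.scal (Sum.inl α)) *
            M.treeVertex ξ [⟨.fld Φ', pa + pb⟩, ⟨.fld Φ, k⟩]) ∧
    -- tree-level vertices of three gauge bosons
    (∀ (a b c : κ ⊕ ω) (pa pb pc : Momentum) (ρ : Fin 4), pa + pb + pc = 0 →
      M.contr b pb (M.contr a pa (M.treeVertex ξ)) [⟨.fld (.W c ρ), pc⟩] =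
        Complex.I * ∑ d, (M.f d a b : ℂ) * ∑ μ, (pa μ : ℂ) *
            M.treeVertex ξ [⟨.fld (.W d μ), pa + pb⟩, ⟨.fld (.W c ρ), pc⟩]
          - Complex.I * (ξ : ℂ)⁻¹ * ((eta ρ * pc ρ : ℝ) : ℂ) *
            M.contr a pa (M.treeVertex ξ) [⟨.antighost c, pc⟩, ⟨.ghost b, pb⟩]) ∧
    -- tree-level vertices of two gauge bosons and a Goldstone boson
    (∀ (a b : κ ⊕ ω) (γ : κ) (pa pb pc : Momentum), pa + pb + pc = 0 →
      M.contr b pb (M.contr a pa (M.treeVertex ξ)) [⟨.fld (.scal (Sum.inl γ)), pc⟩] =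
        (M.massGold a fun α => ∑ δ, M.brsMatrix b (.scal (Sum.inl δ)) (.scal (Sum.inl α)) *
            M.treeVertex ξ
              [⟨.fld (.scal (Sum.inl δ)), pa + pb⟩, ⟨.fld (.scal (Sum.inl γ)), pc⟩])
          - (M.m γ : ℂ) *
            M.contr a pa (M.treeVertex ξ) [⟨.antighost (Sum.inl γ), pc⟩, ⟨.ghost b, pb⟩]) ∧
    -- tree-level four-point vertices
    (∀ (a b : κ ⊕ ω) (pa pb k₁ k₂ : Momentum) (Φ₁ Φ₂ : Fld κ ω η ν), pa + pb + k₁ + k₂ = 0 →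
      M.contr b pb (M.contr a pa (M.treeVertex ξ)) [⟨.fld Φ₁, k₁⟩, ⟨.fld Φ₂, k₂⟩] =
        Complex.I * ∑ c, (M.f c a b : ℂ) * ∑ μ, (pa μ : ℂ) *
            M.treeVertex ξ [⟨.fld (.W c μ), pa + pb⟩, ⟨.fld Φ₁, k₁⟩, ⟨.fld Φ₂, k₂⟩]
          + (M.massGold a fun α => ∑ Φ', M.brsMatrix b Φ' (.scal (Sum.inl α)) *
            M.treeVertex ξ [⟨.fld Φ', pa + pb⟩, ⟨.fld Φ₁, k₁⟩, ⟨.fld Φ₂, k₂⟩])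
          - ∑ Φ', M.brsMatrix b Φ' Φ₁ *
            M.contr a pa (M.treeVertex ξ) [⟨.fld Φ', pb + k₁⟩, ⟨.fld Φ₂, k₂⟩]
          - ∑ Φ', M.brsMatrix b Φ' Φ₂ *
            M.contr a pa (M.treeVertex ξ) [⟨.fld Φ₁, k₁⟩, ⟨.fld Φ', pb + k₂⟩]) := by
  refine ⟨fun Γ hΓ a p L hL => ?_, fun a b pa pb k Φ hk hΦ => ?_, fun a b c pa pb pc ρ hp => ?_,
    fun a b γ pa pb pc hp => ?_, fun a b pa pb k₁ k₂ Φ₁ Φ₂ _ =>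
      M.contr_contr_treeVertex_pair ξ a b pa pb k₁ k₂ Φ₁ Φ₂⟩
  · rw [← M.contr_zjDensity, M.contr_apply]
    -- Whatever field is contracted, it brings in momentum `p`, so the extended list has total
    -- momentum zero and the Zinn-Justin equation applies to it.
    have h : ∀ Ψ, M.zjDensity ξ Γ (⟨Ψ, p⟩ :: L) = 0 := fun Ψ => hΓ _ hL
    simp [h, M.massGold_zero]
  · rw [M.contr_contr_treeVertex_singleton]
    -- The ghost term is absent because the gauge fixing function contains neither Higgs fields nor
    -- fermions.
    have h : ∀ e, M.gaugeFix ξ e [⟨.fld Φ, k⟩] = 0 := by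
      intro e
      rcases hΦ with ⟨i, rfl⟩ | ⟨i, s, rfl⟩ | ⟨i, s, rfl⟩
      · simp [M.gaugeFix_scal, M.massGold_zero]
      · exact M.gaugeFix_of_isOdd ξ e _ rfl
      · exact M.gaugeFix_of_isOdd ξ e _ rfl
    simp only [h, mul_zero, Finset.sum_const_zero, add_zero]
    rfl
  · rw [M.contr_contr_treeVertex_singleton, BrokenGaugeTheory.insertion]
    -- A Goldstone boson rotates only into scalars, and these do not mix with `W` in the `R_ξ` gauge
    -- at zero total momentum.
    have h : ∀ α, ∑ Φ', M.brsMatrix b Φ' (.scal (Sum.inl α)) *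
        M.treeVertex ξ [⟨.fld Φ', pa + pb⟩, ⟨.fld (.W c ρ), pc⟩] = 0 := by
      intro α
      rw [sum_fld]
      simp [BrokenGaugeTheory.brsMatrix, M.treeVertex_pair,
        M.invAction_add_gfAction_scal_W hξ _ c ρ (pa + pb) pc hp]
    simp only [h, M.massGold_zero, add_zero, M.gaugeFix_W, mul_ite, mul_zero, Finset.sum_ite_eq,
      Finset.mem_univ, if_true]
    ring
  · have hξ' : (ξ : ℂ) ≠ 0 := Complex.ofReal_ne_zero.2 hξ
    rw [M.contr_contr_treeVertex_singleton, BrokenGaugeTheory.insertion]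
    have hW : ∀ d μ, M.treeVertex ξ [⟨.fld (.W d μ), pa + pb⟩,
        ⟨.fld (.scal (Sum.inl γ)), pc⟩] = 0 := by
      intro d μ
      -- The absence of mixing is known with the scalar leg in front; commuting legs may be
      -- exchanged.
      have hS := congrFun ((M.fieldPoly_invAction.add (M.fieldPoly_gfAction ξ)).evenSymm
        ⟨.fld (.W d μ), pa + pb⟩ ⟨.fld (.scal (Sum.inl γ)), pc⟩ rfl rfl) []
      have h0 := M.invAction_add_gfAction_scal_W hξ (Sum.inl γ) d μ pc (pa + pb)
        (by rw [add_comm]; exact hp)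
      rw [M.treeVertex_pair]
      exact mul_eq_zero_of_right _ (hS.symm.trans h0)
    have hH : ∀ i, M.treeVertex ξ [⟨.fld (.scal (Sum.inr i)), pa + pb⟩,
        ⟨.fld (.scal (Sum.inl γ)), pc⟩] = 0 := by
      intro i
      rw [M.treeVertex_pair, M.invAction_higgs_gold, M.gfAction_two]
      simp [M.gaugeFix_scal, M.massGold_zero]
    have h : ∀ α, ∑ Φ', M.brsMatrix b Φ' (.scal (Sum.inl α)) *
        M.treeVertex ξ [⟨.fld Φ', pa + pb⟩, ⟨.fld (.scal (Sum.inl γ)), pc⟩] =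
        ∑ δ, M.brsMatrix b (.scal (Sum.inl δ)) (.scal (Sum.inl α)) * M.treeVertex ξ
          [⟨.fld (.scal (Sum.inl δ)), pa + pb⟩, ⟨.fld (.scal (Sum.inl γ)), pc⟩] := by
      intro α
      rw [sum_fld, Fintype.sum_sum_type (α₁ := κ) (α₂ := η)]
      simp [BrokenGaugeTheory.brsMatrix, hH]
    simp only [h, hW, mul_zero, Finset.sum_const_zero, zero_add, M.gaugeFix_scal]
    -- On the leg `φ_γ` only `G_γ` is nonzero, with value `-ξ m_γ`; the prefactor `1/ξ` leaves
    -- `-m_γ`.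
    rw [Finset.sum_eq_single (Sum.inl γ)]
    · simp only [BrokenGaugeTheory.massGold, if_true]
      rw [sub_eq_add_neg]
      congr 1
      simp only [Complex.real_smul]
      field_simp
    · rintro (e | e) _ he
      · have : γ ≠ e := fun h => he (by rw [h])
        simp [BrokenGaugeTheory.massGold, this]
      · simp [BrokenGaugeTheory.massGold]
    · simp
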